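/- Let $A=\mathbb{C}[z,\partial_z]$ be the first Weyl algebra (polynomial differential operators in one variable) and let $Q$ be its quotient (skew) field. For a $\mathbb{C}$-algebra $R$ and a subalgebra $B\subseteq R$ put $N_k(B)=\{a\in R:(\operatorname{ad} b_0)(\operatorname{ad} b_1)\cdots(\operatorname{ad} b_k)(a)=0\text{ for all }b_0,\dots,b_k\in B\}$, where $(\operatorname{ad} b)(a)=ba-ab$. We call $B$ a mad subalgebra of $R$ if $\bigcup_{k\ge 0}N_k(B)=R$ and $B$ equals its own centralizer in $R$ (so that $B$ is commutative). Let $\mathcal{D}$ be a $\mathbb{C}$-subalgebra of $Q$ such that the quotient field of $\mathcal{D}$ is $Q$ (every $f\in Q$ has the form $f=L_2L_1^{-1}$ with $L_1,L_2\in\mathcal{D}$, $L_1\neq 0$) and such that $\mathcal{D}$ contains more than one mad subalgebra. Let $B$ be any mad subalgebra of $\mathcal{D}$. Regard its field of fractions $\operatorname{Frac}B$ as a subfield of $Q$, and let $\overline{B}\subseteq Q$ be the integral closure of $B$ in $\operatorname{Frac}B$. Then there is an $x\in Q$, transcendental over $\mathbb{C}$, such that $\overline{B}=\mathbb{C}[x]$.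 -/

import Mathlib

open Polynomial
open scoped nonZeroDivisors

/-! ### The first Weyl algebra and its quotient field -/

/-- The operator on `ℂ[z]` that multiplies by `z`. -/
noncomputable def opZ : Module.End ℂ ℂ[X] := LinearMap.mulLeft ℂ (X : ℂ[X])

/-- The operator `d/dz` on `ℂ[z]`. -/
noncomputable def opD : Module.End ℂ ℂ[X] := Polynomial.derivative

/-- The first Weyl algebra `ℂ[z, ∂_z]`: the algebra of polynomial differential operators in one
variable, inside the algebra of all linear endomorphisms of `ℂ[z]`. -/
noncomputable def weylSubalgebra : Subalgebra ℂ (Module.End ℂ ℂ[X]) :=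
  Algebra.adjoin ℂ {opZ, opD}

/-- The first Weyl algebra as a type. -/
def WeylAlgebra : Type := weylSubalgebra

noncomputable instance : Ring WeylAlgebra := inferInstanceAs (Ring weylSubalgebra)

noncomputable instance : Algebra ℂ WeylAlgebra := inferInstanceAs (Algebra ℂ weylSubalgebra)

instance : Nontrivial WeylAlgebra := inferInstanceAs (Nontrivial weylSubalgebra)

theorem opD_mul_opZ : opD * opZ = opZ * opD + 1 := by
  apply LinearMap.ext
  intro f
  simp [opD, opZ, derivative_mul, add_comm]

theorem opD_pow_mul_opZ (j : ℕ) : opD ^ j * opZ = opZ * opD ^ j + (j : ℂ) • opD ^ (j - 1) := by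
  induction j with
  | zero => simp
  | succ j ih =>
    rw [pow_succ', mul_assoc, ih, mul_add, ← mul_assoc, opD_mul_opZ, mul_smul_comm, ← pow_succ']
    rcases j with _ | j
    · simp
    · simp only [Nat.add_sub_cancel]
      rw [add_mul, one_mul, mul_assoc, ← pow_succ', add_assoc]
      congr 1
      push_cast
      module

/-- The commutator with `opZ`. -/
noncomputable def adZ : Module.End ℂ ℂ[X] →ₗ[ℂ] Module.End ℂ ℂ[X] :=
  LinearMap.mulRight ℂ opZ - LinearMap.mulLeft ℂ opZ

theorem adZ_apply (T : Module.End ℂ ℂ[X]) : adZ T = T * opZ - opZ * T := by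
  simp [adZ]

theorem adZ_mul (T S : Module.End ℂ ℂ[X]) : adZ (T * S) = adZ T * S + T * adZ S := by
  simp only [adZ_apply, sub_mul, mul_sub, mul_assoc]
  abel

theorem adZ_iterate_mul (N : ℕ) : ∀ (n m : ℕ), n + m = N → ∀ T S : Module.End ℂ ℂ[X],
    (adZ ^ (n + 1)) T = 0 → (adZ ^ (m + 1)) S = 0 →
      (adZ ^ (n + m)) (T * S) = ((n + m).choose n : ℂ) • ((adZ ^ n) T * (adZ ^ m) S) ∧
      (adZ ^ (n + m + 1)) (T * S) = 0 := by
  have hs : ∀ (k : ℕ) (T : Module.End ℂ ℂ[X]), (adZ ^ (k + 1)) T = (adZ ^ k) (adZ T) := by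
    intro k T; rw [pow_succ]; rfl
  have key : ∀ (n m : ℕ) (T S : Module.End ℂ ℂ[X]),
      (adZ ^ (n + 1)) T = 0 → (adZ ^ (m + 1)) S = 0 →
      (adZ ^ (n + m)) (T * S) = ((n + m).choose n : ℂ) • ((adZ ^ n) T * (adZ ^ m) S) →
      (adZ ^ (n + m + 1)) (T * S) = 0 := by
    intro n m T S hT hS h
    rw [pow_succ', Module.End.mul_apply, h, map_smul, adZ_mul]
    rw [← Module.End.mul_apply, ← Module.End.mul_apply, ← pow_succ', ← pow_succ', hT, hS]
    simp
  induction N with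
  | zero =>
    intro n m hnm T S hT hS
    obtain ⟨rfl, rfl⟩ : n = 0 ∧ m = 0 := by omega
    have h0 : (adZ ^ (0 + 0)) (T * S)
        = ((0 + 0 : ℕ).choose 0 : ℂ) • ((adZ ^ 0) T * (adZ ^ 0) S) := by simp
    exact ⟨h0, key 0 0 T S hT hS h0⟩
  | succ N ih =>
    intro n m hnm T S hT hS
    have h0 : (adZ ^ (n + m)) (T * S)
        = ((n + m).choose n : ℂ) • ((adZ ^ n) T * (adZ ^ m) S) := by
      rcases n with _ | n
      · rcases m with _ | m
        · omega
        · have hT' : adZ T = 0 := by simpa using hT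
          have h2 := (ih 0 m (by omega) T (adZ S) hT (by rw [← hs]; exact hS)).1
          rw [show 0 + (m + 1) = (0 + m) + 1 by omega, hs, adZ_mul, hT', zero_mul,
            zero_add (T * adZ S), h2, ← hs]
          simp
      · rcases m with _ | m
        · have hS' : adZ S = 0 := by simpa using hS
          have h2 := (ih n 0 (by omega) (adZ T) S (by rw [← hs]; exact hT) hS).1
          rw [show n + 1 + 0 = (n + 0) + 1 by omega, hs, adZ_mul, hS', mul_zero,
            _root_.add_zero (adZ T * S)]
          rw [Nat.add_zero] at h2
          rw [h2, ← hs]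
          simp
        · have h1 := (ih n (m + 1) (by omega) (adZ T) S (by rw [← hs]; exact hT) hS).1
          have h2 := (ih (n + 1) m (by omega) T (adZ S) hT (by rw [← hs]; exact hS)).1
          rw [show n + 1 + (m + 1) = (n + (m + 1)) + 1 by omega, hs, adZ_mul, map_add, h1,
            show n + (m + 1) = n + 1 + m by omega, h2, ← hs, ← hs, ← add_smul,
            Nat.choose_succ_succ]
          push_cast
          rfl
    exact ⟨h0, key n m T S hT hS h0⟩

theorem weyl_adZ_nilpotent {T : Module.End ℂ ℂ[X]} (hT : T ∈ weylSubalgebra) :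
    ∃ n : ℕ, (adZ ^ (n + 1)) T = 0 := by
  have mono : ∀ (n m : ℕ) (T : Module.End ℂ ℂ[X]), n ≤ m → (adZ ^ n) T = 0 →
      (adZ ^ m) T = 0 := by
    intro n m T h hT
    obtain ⟨k, rfl⟩ := Nat.exists_eq_add_of_le h
    rw [add_comm, pow_add, Module.End.mul_apply, hT, map_zero]
  induction hT using Algebra.adjoin_induction with
  | mem x hx =>
    rcases hx with rfl | hx
    · exact ⟨0, by simp [adZ_apply]⟩
    · rw [Set.mem_singleton_iff] at hx
      subst hx
      refine ⟨1, ?_⟩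
      rw [pow_succ, pow_one, Module.End.mul_apply, adZ_apply opD, opD_mul_opZ, adZ_apply]
      simp
  | algebraMap r =>
    refine ⟨0, ?_⟩
    rw [zero_add, pow_one, adZ_apply, Algebra.commutes, sub_self]
  | add x y _ _ hx hy =>
    obtain ⟨n, hn⟩ := hx
    obtain ⟨m, hm⟩ := hy
    refine ⟨n + m, ?_⟩
    rw [map_add, mono _ _ _ (by omega) hn, mono _ _ _ (by omega) hm, add_zero]
  | mul x y _ _ hx hy =>
    obtain ⟨n, hn⟩ := hx
    obtain ⟨m, hm⟩ := hy
    exact ⟨n + m, (adZ_iterate_mul _ n m rfl x y hn hm).2⟩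

theorem eq_mulLeft_of_adZ_eq_zero {T : Module.End ℂ ℂ[X]} (hT : adZ T = 0) (f : ℂ[X]) :
    T f = f * T 1 := by
  have hc : ∀ g : ℂ[X], T (X * g) = X * T g := by
    intro g
    have := congrArg (fun U : Module.End ℂ ℂ[X] => U g) hT
    simpa [adZ_apply, opZ, sub_eq_zero] using this
  have hp : ∀ n : ℕ, T (X ^ n) = X ^ n * T 1 := by
    intro n
    induction n with
    | zero => simp
    | succ n ih => rw [pow_succ', hc, ih, mul_assoc]
  induction f using Polynomial.induction_on' with
  | add p q hp hq => rw [map_add, hp, hq, add_mul]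
  | monomial n a =>
    rw [← mul_one a, ← smul_eq_mul, ← smul_monomial, monomial_one_right_eq_X_pow, map_smul, hp,
      smul_mul_assoc]

theorem weyl_mul_ne_zero {T S : Module.End ℂ ℂ[X]} (hT : T ∈ weylSubalgebra)
    (hS : S ∈ weylSubalgebra) (hT0 : T ≠ 0) (hS0 : S ≠ 0) : T * S ≠ 0 := by
  classical
  have lead : ∀ U ∈ weylSubalgebra, U ≠ 0 →
      ∃ n : ℕ, (adZ ^ (n + 1)) U = 0 ∧ (adZ ^ n) U ≠ 0 := by
    intro U hU hU0
    have h := weyl_adZ_nilpotent hU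
    refine ⟨Nat.find h, Nat.find_spec h, ?_⟩
    rcases hk : Nat.find h with _ | k
    · simpa using hU0
    · exact Nat.find_min h (by omega)
  obtain ⟨n, hn, hn'⟩ := lead T hT hT0
  obtain ⟨m, hm, hm'⟩ := lead S hS hS0
  intro h0
  have h := (adZ_iterate_mul _ n m rfl T S hn hm).1
  rw [h0, map_zero] at h
  have hch : ((n + m).choose n : ℂ) ≠ 0 := by
    exact_mod_cast (Nat.choose_pos (Nat.le_add_right n m)).ne'
  have hz : (adZ ^ n) T * (adZ ^ m) S = 0 := by
    rcases smul_eq_zero.1 h.symm with h | h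
    · exact absurd h hch
    · exact h
  have one_ne : ∀ U : Module.End ℂ ℂ[X], adZ U = 0 → U ≠ 0 → U 1 ≠ 0 := by
    intro U hU hU0 h1
    apply hU0
    apply LinearMap.ext
    intro f
    rw [eq_mulLeft_of_adZ_eq_zero hU, h1, mul_zero, LinearMap.zero_apply]
  have hTn : adZ ((adZ ^ n) T) = 0 := by rw [← hn, pow_succ']; rfl
  have hSm : adZ ((adZ ^ m) S) = 0 := by rw [← hm, pow_succ']; rfl
  have hev := congrArg (fun U : Module.End ℂ ℂ[X] => U 1) hz
  simp only [Module.End.mul_apply, LinearMap.zero_apply] at hev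
  rw [eq_mulLeft_of_adZ_eq_zero hTn] at hev
  exact mul_ne_zero (one_ne _ hSm hm') (one_ne _ hTn hn') hev

instance weylNoZeroDivisors : NoZeroDivisors WeylAlgebra where
  eq_zero_or_eq_zero_of_mul_eq_zero := by
    rintro ⟨T, hT⟩ ⟨S, hS⟩ h
    by_contra! hne
    refine weyl_mul_ne_zero hT hS ?_ ?_ (congrArg Subtype.val h)
    · exact fun h => hne.1 (Subtype.ext h)
    · exact fun h => hne.2 (Subtype.ext h)

/-- The operators `z^i ∂^j` with `i, j < n`. -/
noncomputable def weylMonomial (n : ℕ) (p : Fin n × Fin n) : Module.End ℂ ℂ[X] :=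
  opZ ^ (p.1 : ℕ) * opD ^ (p.2 : ℕ)

/-- The span of the operators `z^i ∂^j` with `i, j < n`. -/
noncomputable def weylSpan (n : ℕ) : Submodule ℂ (Module.End ℂ ℂ[X]) :=
  Submodule.span ℂ (Set.range (weylMonomial n))

theorem mem_weylSpan {n i j : ℕ} (hi : i < n) (hj : j < n) : opZ ^ i * opD ^ j ∈ weylSpan n :=
  Submodule.subset_span ⟨(⟨i, hi⟩, ⟨j, hj⟩), rfl⟩

theorem weylSpan_le (n : ℕ) : weylSpan n ≤ Subalgebra.toSubmodule weylSubalgebra := by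
  refine Submodule.span_le.2 ?_
  rintro _ ⟨p, rfl⟩
  exact weylSubalgebra.mul_mem (pow_mem (Algebra.subset_adjoin (by simp)) _)
    (pow_mem (Algebra.subset_adjoin (by simp)) _)

theorem weylSpan_mono {n m : ℕ} (h : n ≤ m) : weylSpan n ≤ weylSpan m := by
  refine Submodule.span_le.2 ?_
  rintro _ ⟨p, rfl⟩
  exact mem_weylSpan (p.1.2.trans_le h) (p.2.2.trans_le h)

theorem weylSpan_mul {a : Module.End ℂ ℂ[X]} (ha : a ∈ weylSubalgebra) :
    ∃ k : ℕ, ∀ n, ∀ v ∈ weylSpan n, v * a ∈ weylSpan (n + k) := by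
  have red : ∀ (n m : ℕ) (a : Module.End ℂ ℂ[X]),
      (∀ i j, i < n → j < n → opZ ^ i * opD ^ j * a ∈ weylSpan m) →
      ∀ v ∈ weylSpan n, v * a ∈ weylSpan m := by
    intro n m a h v hv
    induction hv using Submodule.span_induction with
    | mem x hx =>
      obtain ⟨p, rfl⟩ := hx
      exact h _ _ p.1.2 p.2.2
    | zero => rw [zero_mul]; exact zero_mem _
    | add x y _ _ hx hy => rw [add_mul]; exact add_mem hx hy
    | smul c x _ hx => rw [smul_mul_assoc]; exact Submodule.smul_mem _ _ hx
  induction ha using Algebra.adjoin_induction with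
  | mem x hx =>
    rcases hx with rfl | hx
    · refine ⟨1, fun n => red _ _ _ fun i j hi hj => ?_⟩
      rw [mul_assoc, opD_pow_mul_opZ, mul_add, ← mul_assoc, ← pow_succ, mul_smul_comm]
      exact add_mem (mem_weylSpan (by omega) (by omega))
        (Submodule.smul_mem _ _ (mem_weylSpan (by omega) (by omega)))
    · rw [Set.mem_singleton_iff] at hx
      subst hx
      refine ⟨1, fun n => red _ _ _ fun i j hi hj => ?_⟩
      rw [mul_assoc, ← pow_succ]
      exact mem_weylSpan (by omega) (by omega)
  | algebraMap r =>
    refine ⟨0, fun n v hv => ?_⟩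
    rw [← Algebra.commutes, ← Algebra.smul_def]
    exact Submodule.smul_mem _ _ hv
  | add x y _ _ hx hy =>
    obtain ⟨k, hk⟩ := hx
    obtain ⟨l, hl⟩ := hy
    refine ⟨k + l, fun n v hv => ?_⟩
    rw [mul_add]
    exact add_mem (weylSpan_mono (by omega) (hk n v hv)) (weylSpan_mono (by omega) (hl n v hv))
  | mul x y _ _ hx hy =>
    obtain ⟨k, hk⟩ := hx
    obtain ⟨l, hl⟩ := hy
    refine ⟨k + l, fun n v hv => ?_⟩
    rw [← mul_assoc, ← add_assoc]
    exact hl _ _ (hk _ _ hv)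

theorem opZ_pow_mul_opD_pow_X_pow (i j k : ℕ) :
    (opZ ^ i * opD ^ j) (X ^ k : ℂ[X]) = (k.descFactorial j : ℂ) • X ^ (i + (k - j)) := by
  have hz : ∀ (i : ℕ) (f : ℂ[X]), (opZ ^ i) f = X ^ i * f := by
    intro i f
    induction i with
    | zero => simp
    | succ i ih => rw [pow_succ', Module.End.mul_apply, ih, opZ, LinearMap.mulLeft_apply,
        pow_succ', mul_assoc]
  have hd : (opD ^ j) (X ^ k : ℂ[X]) = (k.descFactorial j : ℂ) • X ^ (k - j) := by
    have h := Polynomial.iterate_derivative_X_pow_eq_smul (R := ℂ) k j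
    rw [Module.End.pow_apply]
    simp only [opD]
    rw [h, Nat.cast_smul_eq_nsmul]
  rw [Module.End.mul_apply, hd, hz, mul_smul_comm, pow_add]

theorem weylMonomial_linearIndependent (n : ℕ) : LinearIndependent ℂ (weylMonomial n) := by
  classical
  rw [Fintype.linearIndependent_iff]
  intro g hg
  have main : ∀ j : ℕ, ∀ (hj : j < n) (i : Fin n), g (i, ⟨j, hj⟩) = 0 := by
    intro j
    induction j using Nat.strong_induction_on with
    | _ j ih =>
      intro hj i
      have h := congrArg (fun U : Module.End ℂ ℂ[X] => (U (X ^ j)).coeff i) hg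
      simp only [LinearMap.sum_apply, LinearMap.smul_apply, weylMonomial,
        opZ_pow_mul_opD_pow_X_pow, LinearMap.zero_apply, coeff_zero, finsetSum_coeff,
        coeff_smul, coeff_X_pow, smul_eq_mul] at h
      rw [Finset.sum_eq_single (i, ⟨j, hj⟩)] at h
      · simpa [Nat.descFactorial_self, Nat.factorial_ne_zero] using h
      · rintro ⟨i', j'⟩ - hne
        rcases lt_trichotomy (j' : ℕ) j with hlt | heq | hgt
        · rw [show g (i', j') = 0 from ih j' hlt j'.2 i', zero_mul]
        · have hj' : j' = ⟨j, hj⟩ := Fin.ext heq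
          subst hj'
          have : (i : ℕ) ≠ i' := fun h => hne (by rw [Fin.ext h])
          simp [this]
        · simp [Nat.descFactorial_eq_zero_iff_lt.2 hgt]
      · simp
  rintro ⟨i, j⟩
  exact main j j.2 i

theorem weyl_ore (r s : WeylAlgebra) (hs : s ≠ 0) :
    ∃ r' s' : WeylAlgebra, s' ≠ 0 ∧ s' * r = r' * s := by
  classical
  obtain ⟨k₁, hk₁⟩ := weylSpan_mul r.2
  obtain ⟨k₂, hk₂⟩ := weylSpan_mul s.2
  set k := k₁ + k₂ with hk
  set n := 3 * k + 1 with hn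
  have dim : ∀ m, Module.finrank ℂ (weylSpan m) = m * m := by
    intro m
    rw [weylSpan, finrank_span_eq_card (weylMonomial_linearIndependent m)]
    simp
  have fd : ∀ m, FiniteDimensional ℂ (weylSpan m) := by
    intro m
    exact FiniteDimensional.span_of_finite ℂ (Set.finite_range _)
  have := fd n
  have := fd (n + k)
  let F : weylSpan n × weylSpan n →ₗ[ℂ] Module.End ℂ ℂ[X] :=
    (LinearMap.mulRight ℂ r.1 ∘ₗ (weylSpan n).subtype).coprod
      (-(LinearMap.mulRight ℂ s.1 ∘ₗ (weylSpan n).subtype))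
  have hF : ∀ v, F v = v.1 * r.1 - v.2 * s.1 := by
    intro v
    simp [F, sub_eq_add_neg]
  let G : weylSpan n × weylSpan n →ₗ[ℂ] weylSpan (n + k) := F.codRestrict _ (by
    intro v
    rw [hF]
    exact sub_mem (weylSpan_mono (by omega) (hk₁ n _ v.1.2))
      (weylSpan_mono (by omega) (hk₂ n _ v.2.2)))
  have hker : LinearMap.ker G ≠ ⊥ := by
    refine LinearMap.ker_ne_bot_of_finrank_lt (K := ℂ) (V := weylSpan n × weylSpan n)
      (V₂ := weylSpan (n + k)) (f := G) ?_
    have : Module.Free ℂ (weylSpan n) :=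
      Module.Free.of_basis (Module.Basis.span (weylMonomial_linearIndependent n))
    rw [Module.finrank_prod, dim, dim]
    nlinarith
  obtain ⟨v, hv, hv0⟩ := (Submodule.ne_bot_iff _).1 hker
  have hGv : v.1.1 * r.1 - v.2.1 * s.1 = 0 := by
    rw [← hF]
    exact congrArg Subtype.val (LinearMap.mem_ker.1 hv)
  let a : WeylAlgebra := ⟨v.1, weylSpan_le n v.1.2⟩
  let b : WeylAlgebra := ⟨v.2, weylSpan_le n v.2.2⟩
  have hab : a * r = b * s := Subtype.ext (sub_eq_zero.1 hGv)
  refine ⟨b, a, ?_, hab⟩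
  intro ha
  rw [ha, zero_mul] at hab
  have hb : b = 0 := by
    rcases mul_eq_zero.1 hab.symm with h | h
    · exact h
    · exact absurd h hs
  apply hv0
  ext1
  · exact Subtype.ext (congrArg (fun w : WeylAlgebra => w.1) ha)
  · exact Subtype.ext (congrArg (fun w : WeylAlgebra => w.1) hb)

noncomputable instance weylOreSet : OreLocalization.OreSet (WeylAlgebra⁰) :=
  (OreLocalization.nonempty_oreSet_iff_of_noZeroDivisors (R := WeylAlgebra).2 (by
    intro r s
    obtain ⟨r', s', hs', h⟩ := weyl_ore r s.1 (nonZeroDivisors.ne_zero s.2)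
    exact ⟨r', ⟨s', mem_nonZeroDivisors_of_ne_zero hs'⟩, h⟩)).some

/-- The quotient (skew) field `Q` of the first Weyl algebra. -/
abbrev WeylField : Type := OreLocalization (WeylAlgebra⁰) WeylAlgebra

/-! ### Mad subalgebras -/

section Mad

variable {A : Type*} [Ring A] [Algebra ℂ A]

/-- `N_k(B)`: the elements `a` with `(ad b₀) (ad b₁) ⋯ (ad b_k) a = 0` for all
`b₀, …, b_k ∈ B`, where `(ad b) a = b * a - a * b`. -/
def adKernel (B : Subalgebra ℂ A) (k : ℕ) : Set A :=
  {a | ∀ l : List A, l.length = k + 1 → (∀ b ∈ l, b ∈ B) →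
    l.foldr (fun b c => b * c - c * b) a = 0}

/-- `B` is ad-nilpotent: `A` is the union of the `N_k(B)`. -/
def IsAdNilpotent (B : Subalgebra ℂ A) : Prop := ∀ a : A, ∃ k : ℕ, a ∈ adKernel B k

/-- `B` is a mad subalgebra of `A`: it is ad-nilpotent and equal to its own commutant (so it is
abelian). -/
structure IsMad (B : Subalgebra ℂ A) : Prop where
  adNilpotent : IsAdNilpotent B
  centralizer_eq : Subalgebra.centralizer ℂ (B : Set A) = B

end Mad

/-! ### Fractions and integral closure inside a skew field -/

section Frac

variable {Q : Type*} [DivisionRing Q] [Algebra ℂ Q]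

/-- The quotient field of the subalgebra `D` is all of the skew field `Q`: every element of `Q` is
a fraction `L₂ * L₁⁻¹` with `L₁, L₂ ∈ D`, `L₁ ≠ 0`. -/
def HasQuotientField (D : Subalgebra ℂ Q) : Prop :=
  ∀ f : Q, ∃ L₁ ∈ D, ∃ L₂ ∈ D, L₁ ≠ 0 ∧ f = L₂ * L₁⁻¹

/-- The field of fractions of an abelian subalgebra `B` of the skew field `Q`, as a subset of
`Q`. -/
def fracSet (B : Subalgebra ℂ Q) : Set Q :=
  {f | ∃ a ∈ B, ∃ b ∈ B, b ≠ 0 ∧ f = a * b⁻¹}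

/-- The integral closure of an abelian subalgebra `B` of the skew field `Q` in its field of
fractions: the fractions that are roots of a monic polynomial with coefficients in `B`. (The
fractions commute with `B`, so it does not matter on which side coefficients are written.) -/
def integralClosureSet (B : Subalgebra ℂ Q) : Set Q :=
  {f | f ∈ fracSet B ∧ ∃ p : Polynomial Q, p.Monic ∧ (∀ i, p.coeff i ∈ B) ∧ p.eval f = 0}

end Frac

/-! Write [p, q] = pq − qp. Centralizers of non-scalars in Q are commutative (`weylField_commute`),
so for a non-scalar b in B the kernel of [·, b] on D is exactly B. This derivation is locally
nilpotent on D, and dividing a suitable element of D by one of B gives y in Q with [y, b] = 1. Put K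
= Frac B; then δ = [y, ·] is a derivation of K with field of constants ℂ. Up to lower order an
element of D is f ξ^k with f in K and ξ standing for y, and commutators become Poisson brackets {f
ξ^k, g ξ^l} = (k f δg − l g δf) ξ^(k+l−1) (`HasSlice.isSymbol_commutator`).

A second mad subalgebra contains some e outside B, with symbol a ξ^n, n > 0. As ad e is locally
nilpotent on D, iterating {a ξ^n, ·} kills every element of B. This forces B into a polynomial ring
(`exists_subset_adjoin_of_twist`): a quotient of two consecutive iterates is a coordinate u with
bracket 1, every element of B is a polynomial in u whose homogeneous coefficients the bracket kills,
and those coefficients are scalar multiples of powers of one g because the constants are ℂ. Hence B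
⊆ ℂ[x] with x = g u^d in K. Now ℂ[x] is integrally closed with fraction field K, and x is integral
over B since B contains a nonconstant polynomial in x; so the integral closure is ℂ[x]
(`isIntegral_iff_mem_adjoin`).

Commutativity of centralizers rests on lexicographic leading terms z^i ∂^n, extended to Q: terms of
weights v, w have a commutator of weight v + w − (1, 1) with coefficient multiplied by det(v, w).
Leading weights in a centralizer therefore lie on a line, and powers of a single element approximate
everything in it (`commute_of_commute`). -/

/-! ### Symbols with respect to a locally nilpotent inner derivation -/

section Symbol

variable {R : Type*} [Ring R] [Algebra ℂ R]

/-- The inner derivation `a ↦ a * b - b * a`. -/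
noncomputable def adRight (b : R) : R →ₗ[ℂ] R := LinearMap.mulRight ℂ b - LinearMap.mulLeft ℂ b

theorem adRight_apply (b a : R) : adRight b a = a * b - b * a := by
  simp [adRight]

theorem adRight_mul (b p q : R) : adRight b (p * q) = adRight b p * q + p * adRight b q := by
  simp only [adRight_apply]; noncomm_ring

theorem adRight_commutator (b p q : R) :
    adRight b (p * q - q * p)
      = (adRight b p * q - q * adRight b p) + (p * adRight b q - adRight b q * p) := by
  simp only [adRight_apply]; noncomm_ring

theorem adRight_eq_zero_iff {b a : R} : adRight b a = 0 ↔ a * b = b * a := by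
  rw [adRight_apply, sub_eq_zero]

/-- `f` is the symbol of order `k` of `d` with respect to the derivation `adRight b`. -/
def IsSymbol (b d : R) (k : ℕ) (f : R) : Prop :=
  adRight b f = 0 ∧ (adRight b ^ k) d = (k.factorial : ℂ) • f

/-- On symbols `adRight b` acts as d/dξ, taking f ξ^(k+1) to (k+1) f ξ^k. -/
theorem IsSymbol.derivation {b d f : R} {k : ℕ} (h : IsSymbol b d (k + 1) f) :
    IsSymbol b (adRight b d) k (((k + 1 : ℕ) : ℂ) • f) := by
  refine ⟨by rw [map_smul, h.1, smul_zero], ?_⟩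
  have := h.2
  rw [pow_succ, Module.End.mul_apply] at this
  rw [this, smul_smul, Nat.factorial_succ]
  push_cast
  ring_nf

/-- The data of an inner derivation with a slice `y` and commutative kernel. -/
structure HasSlice (b y : R) : Prop where
  slice : adRight b y = 1
  comm : ∀ p q : R, adRight b p = 0 → adRight b q = 0 → p * q = q * p

variable {b y : R}

/-- An h of order at most 1 differs from c * y, with c = `adRight b h`, by an element of the
commutative kernel, so only c * y contributes to the commutator with f. -/
theorem HasSlice.commutator (H : HasSlice b y) {h f : R} (hh : adRight b (adRight b h) = 0)
    (hf : adRight b f = 0) : h * f - f * h = adRight b h * (y * f - f * y) := by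
  have h1 : adRight b (h - adRight b h * y) = 0 := by
    rw [map_sub, adRight_mul, hh, H.slice]; simp
  have h2 := H.comm _ _ h1 hf
  have h3 := H.comm _ _ hh hf
  generalize adRight b h = c at *
  have h4 : h * f - f * h = c * y * f - f * c * y := by
    rw [sub_mul, mul_sub, ← mul_assoc] at h2
    rw [sub_eq_sub_iff_add_eq_add] at h2 ⊢
    rw [h2]; abel
  rw [h4, ← h3]
  noncomm_ring

theorem HasSlice.adRight_bracket (H : HasSlice b y) {f : R} (hf : adRight b f = 0) :
    adRight b (y * f - f * y) = 0 := by
  rw [adRight_commutator, H.slice, hf]; simp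

/-- The symbol of a commutator is the Poisson bracket of the symbols. -/
theorem HasSlice.isSymbol_commutator (H : HasSlice b y) (N : ℕ) : ∀ {k l : ℕ} {d e f g : R},
    k + l = N + 1 → IsSymbol b d k f → IsSymbol b e l g →
    IsSymbol b (d * e - e * d) N
      ((k : ℂ) • (f * (y * g - g * y)) - (l : ℂ) • (g * (y * f - f * y))) := by
  have ker : ∀ {k l : ℕ} {d e f g : R}, IsSymbol b d k f → IsSymbol b e l g →
      adRight b ((k : ℂ) • (f * (y * g - g * y)) - (l : ℂ) • (g * (y * f - f * y))) = 0 := by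
    intro k l d e f g hd he
    simp only [map_sub (adRight b) (_ • _), map_smul, adRight_mul b _ (_ - _), hd.1, he.1,
      H.adRight_bracket hd.1, H.adRight_bracket he.1]
    simp
  have order_zero : ∀ {d f : R}, IsSymbol b d 0 f → d = f := by
    intro d f h
    simpa using h.2
  induction N with
  | zero =>
    intro k l d e f g hkl hd he
    refine ⟨ker hd he, ?_⟩
    obtain ⟨rfl, rfl⟩ | ⟨rfl, rfl⟩ : (k = 0 ∧ l = 1) ∨ (k = 1 ∧ l = 0) := by omega
    · obtain rfl := order_zero hd
      have he2 : adRight b e = g := by simpa using he.2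
      have := H.commutator (h := e) (f := d) (by rw [he2, he.1]) hd.1
      rw [he2] at this
      simp only [pow_zero, Module.End.one_apply, Nat.factorial_zero, Nat.cast_one, one_smul,
        Nat.cast_zero, zero_smul, zero_sub, ← this, neg_sub]
    · obtain rfl := order_zero he
      have hd2 : adRight b d = f := by simpa using hd.2
      have := H.commutator (h := d) (f := e) (by rw [hd2, hd.1]) he.1
      rw [hd2] at this
      simp only [pow_zero, Module.End.one_apply, Nat.factorial_zero, Nat.cast_one, one_smul,
        Nat.cast_zero, zero_smul, sub_zero, ← this]
  | succ N ih =>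
    intro k l d e f g hkl hd he
    refine ⟨ker hd he, ?_⟩
    -- By the Leibniz rule one application of `adRight b` gives [d', e] + [d, e'], both of total
    -- order one less. Their Poisson brackets add up to N + 1 times the bracket sought. If d or e
    -- has order 0, one summand vanishes.
    rw [pow_succ, Module.End.mul_apply, adRight_commutator, map_add]
    rcases k with _ | k
    · obtain rfl := order_zero hd
      rcases l with _ | l
      · omega
      have h2 := (ih (by omega) hd he.derivation).2
      rw [h2, hd.1]
      obtain rfl : l = N + 1 := by omega
      simp only [zero_mul, mul_zero, sub_zero, map_zero, zero_add, Nat.cast_zero, zero_smul,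
        smul_mul_assoc, Nat.factorial_succ N]
      push_cast
      module
    · rcases l with _ | l
      · obtain rfl := order_zero he
        have h2 := (ih (by omega) hd.derivation he).2
        rw [h2, he.1]
        obtain rfl : k = N + 1 := by omega
        simp only [zero_mul, mul_zero, sub_zero, map_zero, add_zero, Nat.cast_zero, zero_smul,
          smul_mul_assoc, Nat.factorial_succ N]
        push_cast
        module
      · have h1 := (ih (by omega) hd.derivation he).2
        have h2 := (ih (by omega) hd he.derivation).2
        rw [h1, h2]
        have hN : (N : ℂ) = k + l := by
          have : N = k + l := by omega
          exact_mod_cast this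
        simp only [smul_mul_assoc, mul_smul_comm, ← smul_sub, Nat.factorial_succ N]
        push_cast
        rw [hN]
        module

end Symbol

/-! ### A twisted locally nilpotent derivation on a field -/

section Twisted

variable {K : Type*} [Field K] [Algebra ℂ K]

/-- The Poisson bracket with `a ξ ^ n`, restricted to the homogeneous part of degree
`i * (n - 1)` of `K[ξ, ξ⁻¹]`. -/
noncomputable def twist (δ : Derivation ℂ K K) (a : K) (n : ℕ) (i : ℤ) : K →ₗ[ℂ] K :=
  LinearMap.mulLeft ℂ ((n : K) * a) ∘ₗ (δ : K →ₗ[ℂ] K)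
    - LinearMap.mulLeft ℂ ((i : K) * ((n : K) - 1) * δ a)

/-- The composite of `N` consecutive maps `twist`, beginning with the index `i`. -/
noncomputable def twistIter (δ : Derivation ℂ K K) (a : K) (n : ℕ) : ℕ → ℤ → K → K
  | 0, _, f => f
  | N + 1, i, f => twistIter δ a n N (i + 1) (twist δ a n i f)

variable {δ : Derivation ℂ K K} {a : K} {n : ℕ}

theorem twist_apply (i : ℤ) (f : K) :
    twist δ a n i f = n * a * δ f - i * ((n : K) - 1) * δ a * f := by
  simp [twist, mul_assoc]

/-- The bracket with a ξ^n is a derivation, and degrees add under multiplication. The index i is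
recorded instead of the degree i(n − 1), so that the grading survives when n = 1. -/
theorem twist_mul (i j : ℤ) (f g : K) :
    twist δ a n (i + j) (f * g) = twist δ a n i f * g + f * twist δ a n j g := by
  simp only [twist_apply, Derivation.leibniz, smul_eq_mul]
  push_cast
  ring

theorem twist_one : twist δ a n 0 1 = 0 := by
  simp [twist_apply]

theorem twist_inv {i : ℤ} {f : K} (hf : f ≠ 0) (h : twist δ a n i f = 0) :
    twist δ a n (-i) f⁻¹ = 0 := by
  have h1 := twist_mul (δ := δ) (a := a) (n := n) i (-i) f f⁻¹
  rw [add_neg_cancel, mul_inv_cancel₀ hf, twist_one, h, zero_mul, zero_add] at h1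
  exact (mul_eq_zero.1 h1.symm).resolve_left hf

theorem twist_pow_of_eq_zero {i : ℤ} {f : K} (h : twist δ a n i f = 0) (k : ℕ) :
    twist δ a n (k * i) (f ^ k) = 0 := by
  induction k with
  | zero => simpa using twist_one
  | succ k ih =>
    rw [show ((k + 1 : ℕ) : ℤ) * i = k * i + i by push_cast; ring, pow_succ, twist_mul, ih, h]
    simp

theorem twist_slice_pow {u : K} (hu : twist δ a n (-1) u = 1) (k : ℕ) :
    twist δ a n (-(k + 1 : ℕ)) (u ^ (k + 1)) = ((k + 1 : ℕ) : ℂ) • u ^ k := by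
  induction k with
  | zero => simpa using hu
  | succ k ih =>
    rw [show (-((k + 1 + 1 : ℕ) : ℤ)) = -((k + 1 : ℕ) : ℤ) + -1 by push_cast; ring, pow_succ,
      twist_mul, ih, hu, smul_mul_assoc, ← pow_succ, mul_one]
    push_cast
    module

theorem twistIter_succ' (N : ℕ) : ∀ (i : ℤ) (f : K),
    twistIter δ a n (N + 1) i f = twist δ a n (i + N) (twistIter δ a n N i f) := by
  induction N with
  | zero => intro i f; simp [twistIter]
  | succ N ih =>
    intro i f
    rw [twistIter, ih, twistIter]
    congr 1
    push_cast
    ring_nf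

/-- With u as coordinate, `twist` behaves like d/du. The expansion of `twist δ a n i f` is
integrated term by term to g, and f − g is killed, hence serves as the constant term. -/
theorem exists_taylor {u : K} (hu : twist δ a n (-1) u = 1) (N : ℕ) : ∀ (i : ℤ) (f : K),
    twistIter δ a n N i f = 0 →
      ∃ γ : ℕ → K, (∀ j : ℕ, twist δ a n (i + j) (γ j) = 0) ∧
        f = ∑ j ∈ Finset.range N, γ j * u ^ j := by
  induction N with
  | zero =>
    intro i f h
    exact ⟨0, by simp, by simpa [twistIter] using h⟩
  | succ N ih =>
    intro i f h
    obtain ⟨γ, hγ, hf⟩ := ih (i + 1) _ h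
    set g : K := ∑ j ∈ Finset.range N, ((j + 1 : ℕ) : ℂ)⁻¹ • (γ j * u ^ (j + 1)) with hg
    have hEg : twist δ a n i g = twist δ a n i f := by
      rw [hf, hg, map_sum]
      refine Finset.sum_congr rfl fun j _ => ?_
      have h1 := twist_mul (δ := δ) (a := a) (n := n) (i + 1 + j) (-(j + 1 : ℕ)) (γ j)
        (u ^ (j + 1))
      rw [hγ, twist_slice_pow hu, zero_mul, zero_add,
        show i + 1 + (j : ℤ) + -((j + 1 : ℕ) : ℤ) = i by push_cast; ring] at h1
      rw [map_smul, h1, mul_smul_comm, smul_smul, inv_mul_cancel₀ (by exact_mod_cast j.succ_ne_zero),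
        one_smul]
    refine ⟨fun j => match j with
      | 0 => f - g
      | j + 1 => ((j + 1 : ℕ) : ℂ)⁻¹ • γ j, ?_, ?_⟩
    · rintro (_ | j)
      · simp [hEg]
      · simp only [map_smul]
        rw [show i + ((j + 1 : ℕ) : ℤ) = i + 1 + j by push_cast; ring, hγ, smul_zero]
    · rw [Finset.sum_range_succ']
      simp only [smul_mul_assoc, pow_zero, mul_one]
      rw [← hg]; ring

/-- Let τ be the last nonzero iterate and s the one before it. Then s maps to τ and τ is killed, so
s / τ maps to 1; its index is i − (i + 1) = −1. -/
theorem exists_twist_slice {f : K} {N : ℕ} (h : twistIter δ a n N 0 f = 0)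
    (hf : twist δ a n 0 f ≠ 0) :
    ∃ i : ℕ, twistIter δ a n (i + 1) 0 f ≠ 0 ∧
      twist δ a n (-1) (twistIter δ a n i 0 f * (twistIter δ a n (i + 1) 0 f)⁻¹) = 1 := by
  classical
  have hex : ∃ N, twistIter δ a n N 0 f = 0 := ⟨N, h⟩
  have hspec := Nat.find_spec hex
  have hmin := fun k => Nat.find_min (m := k) hex
  have hf0 : f ≠ 0 := by rintro rfl; exact hf (map_zero _)
  obtain ⟨i, hi⟩ : ∃ i, Nat.find hex = i + 2 := by
    rcases hk : Nat.find hex with _ | _ | i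
    · rw [hk] at hspec; exact absurd hspec hf0
    · rw [hk] at hspec; exact absurd hspec hf
    · exact ⟨i, rfl⟩
  rw [hi] at hspec hmin
  refine ⟨i, hmin (i + 1) (by omega), ?_⟩
  have hτ := hmin (i + 1) (by omega)
  rw [twistIter_succ'] at hspec
  have e1 : twist δ a n i (twistIter δ a n i 0 f) = twistIter δ a n (i + 1) 0 f := by
    rw [twistIter_succ']; simp
  set s := twistIter δ a n i 0 f
  set τ := twistIter δ a n (i + 1) 0 f
  have hinv := twist_inv hτ hspec
  have h1 := twist_mul (δ := δ) (a := a) (n := n) i (-(0 + ((i + 1 : ℕ) : ℤ))) s τ⁻¹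
  rw [hinv, mul_zero, add_zero, e1, mul_inv_cancel₀ hτ] at h1
  rw [← h1]
  congr 2
  push_cast; ring

/-- A set of elements killed by the iterated twisted derivation lies in a polynomial ring. -/
theorem exists_subset_adjoin_of_twist (hconst : ∀ f : K, δ f = 0 → ∃ c : ℂ, f = algebraMap ℂ K c)
    (ha : a ≠ 0) (hn : 0 < n) (B : Set K) (hB : ∀ b ∈ B, ∃ N, twistIter δ a n N 0 b = 0)
    {b₁ : K} (hb₁ : b₁ ∈ B) (hδ : δ b₁ ≠ 0) :
    ∃ x : K, B ⊆ (Algebra.adjoin ℂ {x} : Set K) := by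
  have : CharZero K := charZero_of_injective_algebraMap (algebraMap ℂ K).injective
  have hn0 : (n : K) ≠ 0 := by exact_mod_cast hn.ne'
  obtain ⟨N, hN⟩ := hB b₁ hb₁
  obtain ⟨i, -, hu⟩ := exists_twist_slice hN (by
    simp [twist_apply, hn0, ha, hδ])
  set u := twistIter δ a n i 0 b₁ * (twistIter δ a n (i + 1) 0 b₁)⁻¹
  -- The quotient f / g has index 0 and is killed; at index 0 the twist is n a δ, so the quotient is
  -- a constant of δ.
  have ratio : ∀ (j : ℤ) (f g : K), g ≠ 0 → twist δ a n j f = 0 → twist δ a n j g = 0 →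
      ∃ c : ℂ, f = c • g := by
    intro j f g hg hf' hg'
    have h1 := twist_mul (δ := δ) (a := a) (n := n) j (-j) f g⁻¹
    rw [hf', twist_inv hg hg', add_neg_cancel, twist_apply] at h1
    have h2 : δ (f * g⁻¹) = 0 := by
      simpa [hn0, ha] using h1
    obtain ⟨c, hc⟩ := hconst _ h2
    refine ⟨c, ?_⟩
    rw [Algebra.smul_def, ← hc]
    field_simp
  -- The indices that carry a nonzero element killed by the twist.
  let J : AddSubgroup ℤ :=
    { carrier := {j | ∃ f : K, f ≠ 0 ∧ twist δ a n j f = 0}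
      zero_mem' := ⟨1, one_ne_zero, twist_one⟩
      add_mem' := by
        rintro i j ⟨f, hf, hf'⟩ ⟨g, hg, hg'⟩
        exact ⟨f * g, mul_ne_zero hf hg, by rw [twist_mul, hf', hg']; simp⟩
      neg_mem' := by
        rintro i ⟨f, hf, hf'⟩
        exact ⟨f⁻¹, inv_ne_zero hf, twist_inv hf hf'⟩ }
  have hnJ : (n : ℤ) ∈ J := by
    -- The bracket of a ξ^n with its own power (a ξ^n)^(n−1) vanishes, and that power has degree n(n
    -- − 1), which is index n.
    refine ⟨a ^ (n - 1), pow_ne_zero _ ha, ?_⟩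
    obtain ⟨m, rfl⟩ := Nat.exists_eq_succ_of_ne_zero hn.ne'
    rcases m with _ | m
    · simp [twist_apply]
    · simp [twist_apply, Derivation.leibniz_pow]
      ring
  obtain ⟨d, hd⟩ := Int.subgroup_cyclic J
  obtain ⟨d, hd0, hd⟩ : ∃ d : ℕ, 0 < d ∧ ∀ j, j ∈ J ↔ (d : ℤ) ∣ j := by
    have h1 : ∀ j, j ∈ J ↔ d ∣ j := by
      intro j
      rw [hd, ← AddSubgroup.zmultiples_eq_closure, Int.mem_zmultiples_iff]
    refine ⟨d.natAbs, ?_, fun j => by rw [h1, Int.natAbs_dvd]⟩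
    rw [Int.natAbs_pos]
    rintro rfl
    have := (h1 n).1 hnJ
    rw [zero_dvd_iff] at this
    omega
  obtain ⟨g, hg0, hg⟩ : (d : ℤ) ∈ J := (hd d).2 dvd_rfl
  -- The index of g u^d is d − d = 0, the index of elements of B. A nonzero coefficient γ_j has j =
  -- d k and equals c g^k, so γ_j u^j = c (g u^d)^k.
  refine ⟨g * u ^ d, fun b hb => ?_⟩
  obtain ⟨N, hN⟩ := hB b hb
  obtain ⟨γ, hγ, rfl⟩ := exists_taylor hu N 0 b hN
  refine Subalgebra.sum_mem _ fun j _ => ?_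
  have hγj : twist δ a n j (γ j) = 0 := by simpa using hγ j
  by_cases h0 : γ j = 0
  · rw [h0, zero_mul]; exact Subalgebra.zero_mem _
  have hdj : (d : ℤ) ∣ j := (hd j).1 ⟨γ j, h0, hγj⟩
  obtain ⟨k, rfl⟩ := Int.natCast_dvd_natCast.1 hdj
  have hgk := twist_pow_of_eq_zero hg k
  obtain ⟨c, hc⟩ := ratio _ _ _ (pow_ne_zero k hg0) hγj (by
    rw [← hgk]; push_cast; ring_nf)
  rw [hc, smul_mul_assoc, pow_mul, ← mul_pow]
  exact Subalgebra.smul_mem _ (Subalgebra.pow_mem _ (Algebra.self_mem_adjoin_singleton ℂ _) k) c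

end Twisted

/-! ### Leading terms with lexicographically ordered weights -/

section Leading

/-- Weights of leading terms, ordered lexicographically. -/
abbrev Weight : Type := ℤ ×ₗ ℤ

/-- The standard alternating form on weights. -/
def weightDet (v w : Weight) : ℤ :=
  (ofLex v).1 * (ofLex w).2 - (ofLex v).2 * (ofLex w).1

theorem weightDet_add_left (u v w : Weight) :
    weightDet (u + v) w = weightDet u w + weightDet v w := by
  simp only [weightDet, ofLex_add, Prod.fst_add, Prod.snd_add]; ring

theorem weightDet_add_right (u v w : Weight) :
    weightDet u (v + w) = weightDet u v + weightDet u w := by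
  simp only [weightDet, ofLex_add, Prod.fst_add, Prod.snd_add]; ring

theorem weightDet_swap (v w : Weight) : weightDet v w = -weightDet w v := by
  simp only [weightDet]; ring

/-- The weight by which the commutator lowers leading terms. -/
def weightShift : Weight := toLex (1, 1)

/-- The relation `Lt p w c` says that `p` has no terms of weight above `w`, and that the coefficient
of weight `w` of `p` is `c`. -/
structure IsLeading {R : Type*} [Ring R] [Algebra ℂ R] (Lt : R → Weight → ℂ → Prop) : Prop where
  add : ∀ {p q w c d}, Lt p w c → Lt q w d → Lt (p + q) w (c + d)
  mul : ∀ {p q v w c d}, Lt p v c → Lt q w d → Lt (p * q) (v + w) (c * d)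
  lower : ∀ {p v w c}, Lt p v c → v < w → Lt p w 0
  zero_iff : ∀ {w c}, Lt 0 w c ↔ c = 0
  one : Lt 1 0 1
  smul : ∀ {p w c} (a : ℂ), Lt p w c → Lt (a • p) w (a * c)
  exists_lead : ∀ {p}, p ≠ 0 → ∃ w c, c ≠ 0 ∧ Lt p w c

/-- The leading term of a commutator is given by the alternating form on weights. -/
def CommLeading {R : Type*} [Ring R] (Lt : R → Weight → ℂ → Prop) (p q : R) : Prop :=
  ∀ ⦃v w c d⦄, Lt p v c → Lt q w d →
    Lt (p * q - q * p) (v + w - weightShift) (weightDet v w * (c * d))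

namespace IsLeading

variable {R : Type*} [Ring R] [Algebra ℂ R] {Lt : R → Weight → ℂ → Prop} (H : IsLeading Lt)

include H

theorem neg {p : R} {w : Weight} {c : ℂ} (h : Lt p w c) : Lt (-p) w (-c) := by
  simpa using H.smul (-1) h

theorem sub {p q : R} {w : Weight} {c d : ℂ} (h : Lt p w c) (h' : Lt q w d) :
    Lt (p - q) w (c - d) := by
  rw [sub_eq_add_neg, sub_eq_add_neg]; exact H.add h (H.neg h')

theorem unique {p : R} {w : Weight} {c d : ℂ} (h : Lt p w c) (h' : Lt p w d) : c = d := by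
  have := H.sub h h'
  rwa [sub_self, H.zero_iff, sub_eq_zero] at this

theorem cases_of_lead {p : R} {v w : Weight} {c d : ℂ} (hc : c ≠ 0) (h : Lt p v c)
    (h' : Lt p w d) : (w = v ∧ d = c) ∨ (v < w ∧ d = 0) := by
  rcases lt_trichotomy v w with hlt | rfl | hgt
  · exact Or.inr ⟨hlt, H.unique h' (H.lower h hlt)⟩
  · exact Or.inl ⟨rfl, H.unique h' h⟩
  · exact absurd (H.unique h (H.lower h' hgt)) hc

theorem lead_unique {p : R} {v w : Weight} {c d : ℂ} (hc : c ≠ 0) (hd : d ≠ 0) (h : Lt p v c)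
    (h' : Lt p w d) : w = v ∧ d = c :=
  (H.cases_of_lead hc h h').resolve_right fun h => hd h.2

theorem ne_zero {p : R} {v : Weight} {c : ℂ} (hc : c ≠ 0) (h : Lt p v c) : p ≠ 0 := by
  rintro rfl
  exact hc (H.zero_iff.1 h)

theorem lt_of_zero {p : R} {v w : Weight} {c : ℂ} (hc : c ≠ 0) (h : Lt p v c) (h' : Lt p w 0) :
    v < w := by
  rcases H.cases_of_lead hc h h' with h | h
  · exact absurd h.2.symm hc
  · exact h.1

theorem cancel_left {s q : R} {v w : Weight} {c d : ℂ} (hc : c ≠ 0) (hs : Lt s v c)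
    (h : Lt (s * q) (v + w) (c * d)) : Lt q w d := by
  by_cases hq : q = 0
  · subst hq
    rw [mul_zero, H.zero_iff] at h
    exact H.zero_iff.2 ((mul_eq_zero.1 h).resolve_left hc)
  obtain ⟨w', d', hd', hq'⟩ := H.exists_lead hq
  rcases H.cases_of_lead (mul_ne_zero hc hd') (H.mul hs hq') h with ⟨h1, h2⟩ | ⟨h1, h2⟩
  · rw [add_left_cancel h1, mul_left_cancel₀ hc h2]
    exact hq'
  · rw [(mul_eq_zero.1 h2).resolve_left hc]
    exact H.lower hq' (lt_of_add_lt_add_left h1)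

theorem cancel_right {s q : R} {v w : Weight} {c d : ℂ} (hc : c ≠ 0) (hs : Lt s v c)
    (h : Lt (q * s) (w + v) (d * c)) : Lt q w d := by
  by_cases hq : q = 0
  · subst hq
    rw [zero_mul, H.zero_iff] at h
    exact H.zero_iff.2 ((mul_eq_zero.1 h).resolve_right hc)
  obtain ⟨w', d', hd', hq'⟩ := H.exists_lead hq
  rcases H.cases_of_lead (mul_ne_zero hd' hc) (H.mul hq' hs) h with ⟨h1, h2⟩ | ⟨h1, h2⟩
  · rw [add_right_cancel h1, mul_right_cancel₀ hc h2]
    exact hq'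
  · rw [(mul_eq_zero.1 h2).resolve_right hc]
    exact H.lower hq' (lt_of_add_lt_add_right h1)

theorem commLeading_symm {p q : R} (h : CommLeading Lt p q) : CommLeading Lt q p := by
  intro v w c d hq hp
  have := H.neg (h hp hq)
  rw [neg_sub, add_comm w v] at this
  convert this using 1
  rw [weightDet_swap v w]
  push_cast
  ring

end IsLeading

/-! ### Extension of leading terms to a skew field of fractions -/

section Extension

variable {A Q : Type*} [Ring A] [Algebra ℂ A] [DivisionRing Q] [Algebra ℂ Q]

/-- The extension of a leading term relation to fractions. -/
def extendLeading (ι : A →ₐ[ℂ] Q) (Lt : A → Weight → ℂ → Prop) (q : Q) (w : Weight) (c : ℂ) :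
    Prop :=
  ∃ s r v d, d ≠ 0 ∧ Lt s v d ∧ ι s * q = ι r ∧ Lt r (v + w) (d * c)

variable {ι : A →ₐ[ℂ] Q} (hι : Function.Injective ι)
  (hfrac : ∀ q : Q, ∃ s r : A, s ≠ 0 ∧ ι s * q = ι r) {Lt : A → Weight → ℂ → Prop}
  (H : IsLeading Lt)

include hι hfrac

theorem exists_common_multiple {s : A} (hs : s ≠ 0) (r : A) :
    ∃ α β : A, α ≠ 0 ∧ α * r = β * s := by
  obtain ⟨α, β, hα, h⟩ := hfrac (ι r * (ι s)⁻¹)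
  have hs' : ι s ≠ 0 := (map_ne_zero_iff ι hι).2 hs
  refine ⟨α, β, hα, hι ?_⟩
  rw [map_mul, map_mul, ← h, mul_assoc, mul_assoc, inv_mul_cancel₀ hs', mul_one]

include H

/-- Independence of the chosen fraction: two denominators are brought to a common multiple α s₀ = β
s, and multiplicativity of leading terms allows β to be cancelled. -/
theorem extendLeading_apply {q : Q} {w : Weight} {c : ℂ} (hq : extendLeading ι Lt q w c)
    {s r : A} {v : Weight} {d : ℂ} (hd : d ≠ 0) (hs : Lt s v d) (hsr : ι s * q = ι r) :
    Lt r (v + w) (d * c) := by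
  obtain ⟨s₀, r₀, v₀, d₀, hd₀, hs₀, hsr₀, hr₀⟩ := hq
  obtain ⟨α, β, hα, hαβ⟩ := exists_common_multiple hι hfrac (H.ne_zero hd hs) s₀
  have hs₀' := (map_ne_zero_iff ι hι).2 (H.ne_zero hd₀ hs₀)
  have hα' := (map_ne_zero_iff ι hι).2 hα
  have hβ : β ≠ 0 := by
    rintro rfl
    have := congrArg ι hαβ
    rw [zero_mul, map_mul, map_zero] at this
    exact mul_ne_zero hα' hs₀' this
  obtain ⟨wα, cα, hcα, hα1⟩ := H.exists_lead hα
  obtain ⟨wβ, cβ, hcβ, hβ1⟩ := H.exists_lead hβ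
  have h1 := H.mul hα1 hs₀
  rw [hαβ] at h1
  obtain ⟨h2, h3⟩ := H.lead_unique (mul_ne_zero hcα hd₀) (mul_ne_zero hcβ hd) h1 (H.mul hβ1 hs)
  have h4 : α * r₀ = β * r := by
    apply hι
    rw [map_mul, map_mul, ← hsr₀, ← hsr, ← mul_assoc, ← mul_assoc, ← map_mul, ← map_mul, hαβ]
  have h5 := H.mul hα1 hr₀
  rw [h4, ← add_assoc, ← mul_assoc, ← h2, ← h3, add_assoc, mul_assoc] at h5
  exact H.cancel_left hcβ hβ1 h5

theorem extendLeading_coe {p : A} {w : Weight} {c : ℂ} :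
    extendLeading ι Lt (ι p) w c ↔ Lt p w c := by
  constructor
  · intro h
    simpa using extendLeading_apply hι hfrac H h one_ne_zero H.one (r := p) (by simp)
  · intro h
    exact ⟨1, p, 0, 1, one_ne_zero, H.one, by simp, by simpa using h⟩

theorem isLeading_extendLeading : IsLeading (extendLeading ι Lt) where
  add := by
    intro p q w c d hp hq
    obtain ⟨s, r, hs, hsr⟩ := hfrac p
    obtain ⟨s', r', hs', hsr'⟩ := hfrac q
    obtain ⟨α, β, hα, hαβ⟩ := exists_common_multiple hι hfrac hs' s
    have h0 : α * s ≠ 0 := by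
      intro h
      have := congrArg ι h
      rw [map_mul, map_zero] at this
      exact mul_ne_zero ((map_ne_zero_iff ι hι).2 hα) ((map_ne_zero_iff ι hι).2 hs) this
    obtain ⟨v, e, he, hv⟩ := H.exists_lead h0
    have e1 : ι (α * s) * p = ι (α * r) := by rw [map_mul, mul_assoc, hsr, map_mul]
    have e2 : ι (α * s) * q = ι (β * r') := by rw [hαβ, map_mul, mul_assoc, hsr', map_mul]
    have h1 := extendLeading_apply hι hfrac H hp he hv e1
    have h2 := extendLeading_apply hι hfrac H hq he hv e2
    refine ⟨α * s, α * r + β * r', v, e, he, hv, by rw [mul_add, e1, e2, map_add], ?_⟩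
    rw [mul_add]
    exact H.add h1 h2
  mul := by
    rintro p q w w' c c' ⟨s, r, v, d, hd, hs, hsr, hr⟩ ⟨s', r', v', d', hd', hs', hsr', hr'⟩
    -- In s⁻¹ r s'⁻¹ r' the middle r s'⁻¹ is rewritten as α⁻¹ β, so that the product is the left
    -- fraction (α s)⁻¹ (β r').
    obtain ⟨α, β, hα, hαβ⟩ := exists_common_multiple hι hfrac (H.ne_zero hd' hs') r
    obtain ⟨wα, cα, hcα, hα1⟩ := H.exists_lead hα
    have h1 := H.mul hα1 hr
    rw [hαβ] at h1
    have h2 : Lt β (wα + (v + w) - v') (cα * (d * c) / d') := by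
      refine H.cancel_right hd' hs' ?_
      rwa [sub_add_cancel, div_mul_cancel₀ _ hd']
    refine ⟨α * s, β * r', wα + v, cα * d, mul_ne_zero hcα hd, H.mul hα1 hs, ?_, ?_⟩
    · rw [map_mul, mul_assoc, ← mul_assoc (ι s), hsr, ← mul_assoc, ← map_mul, hαβ, map_mul,
        mul_assoc, hsr', map_mul]
    · convert H.mul h2 hr' using 1
      · abel
      · field_simp
  lower := by
    rintro p w w' c ⟨s, r, v, d, hd, hs, hsr, hr⟩ hlt
    refine ⟨s, r, v, d, hd, hs, hsr, ?_⟩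
    rw [mul_zero]
    exact H.lower hr (by gcongr)
  zero_iff := by
    intro w c
    constructor
    · rintro ⟨s, r, v, d, hd, hs, hsr, hr⟩
      rw [mul_zero, eq_comm, map_eq_zero_iff ι hι] at hsr
      rw [hsr, H.zero_iff] at hr
      exact (mul_eq_zero.1 hr).resolve_left hd
    · rintro rfl
      exact ⟨1, 0, 0, 1, one_ne_zero, H.one, by simp, by simp [H.zero_iff]⟩
  one := ⟨1, 1, 0, 1, one_ne_zero, H.one, by simp, by simpa using H.one⟩
  smul := by
    rintro p w c a ⟨s, r, v, d, hd, hs, hsr, hr⟩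
    refine ⟨s, a • r, v, d, hd, hs, by rw [mul_smul_comm, hsr, map_smul], ?_⟩
    rw [mul_left_comm]
    exact H.smul a hr
  exists_lead := by
    intro p hp
    obtain ⟨s, r, hs, hsr⟩ := hfrac p
    have hr : r ≠ 0 := by
      rintro rfl
      rw [map_zero] at hsr
      exact mul_ne_zero ((map_ne_zero_iff ι hι).2 hs) hp hsr
    obtain ⟨v, d, hd, hv⟩ := H.exists_lead hs
    obtain ⟨w, c, hc, hw⟩ := H.exists_lead hr
    refine ⟨w - v, c / d, div_ne_zero hc hd, s, r, v, d, hd, hv, hsr, ?_⟩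
    rwa [add_sub_cancel, mul_div_cancel₀ _ hd]

/-- If s p = r then s [p, q] = [r, q] − [s, q] p. The coefficients match because det(v + w, w') −
det(v, w') = det(w, w'), and s is cancelled. -/
theorem commLeading_of_coe {q : Q} (h : ∀ a : A, CommLeading (extendLeading ι Lt) (ι a) q) (p : Q) :
    CommLeading (extendLeading ι Lt) p q := by
  have H' := isLeading_extendLeading hι hfrac H
  intro w w' c c' hp hq
  obtain ⟨s, r, v, d, hd, hs, hsr, hr⟩ := id hp
  have hs' := (extendLeading_coe hι hfrac H).2 hs
  have h1 := h r ((extendLeading_coe hι hfrac H).2 hr) hq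
  have h2 := H'.mul (h s hs' hq) hp
  rw [show v + w' - weightShift + w = v + w + w' - weightShift by abel] at h2
  have h3 := H'.sub h1 h2
  refine H'.cancel_left hd hs' ?_
  convert h3 using 1
  · rw [← hsr]; noncomm_ring
  · abel
  · rw [weightDet_add_left]; push_cast; ring

theorem commLeading_extendLeading (h : ∀ a b : A, CommLeading Lt a b) (p q : Q) :
    CommLeading (extendLeading ι Lt) p q := by
  have H' := isLeading_extendLeading hι hfrac H
  refine commLeading_of_coe hι hfrac H (fun a => H'.commLeading_symm ?_) p
  refine commLeading_of_coe hι hfrac H (fun b => ?_) q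
  intro v w c d hb ha
  have h1 := h b a ((extendLeading_coe hι hfrac H).1 hb) ((extendLeading_coe hι hfrac H).1 ha)
  rw [← map_mul, ← map_mul, ← map_sub]
  exact (extendLeading_coe hι hfrac H).2 h1

end Extension

/-! ### Centralizers -/

section Centralizer

variable {Q : Type*} [DivisionRing Q] [Algebra ℂ Q] {Lt : Q → Weight → ℂ → Prop}

/-- The weights w with det(v, w) = 0 lie on the line through v, where the lexicographic order is the
order of a single coordinate: the first, unless v has first coordinate 0. -/
theorem exists_weight_hom {v : Weight} (hv : v ≠ 0) :
    ∃ φ : Weight →+ ℤ, ∀ w, weightDet v w = 0 → 0 < w → 0 < φ w := by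
  by_cases h1 : (ofLex v).1 = 0
  · have h2 : (ofLex v).2 ≠ 0 := fun h2 => hv (by
      rw [← ofLex_eq_zero]; exact Prod.ext h1 h2)
    refine ⟨⟨⟨fun w => (ofLex w).2, rfl⟩, fun _ _ => rfl⟩, fun w hw hpos => ?_⟩
    change 0 < (ofLex w).2
    rw [weightDet, h1, zero_mul, zero_sub, neg_eq_zero] at hw
    have hw1 := (mul_eq_zero.1 hw).resolve_left h2
    rcases Prod.Lex.lt_iff.1 hpos with h | h
    · rw [hw1] at h; exact absurd h (by simp)
    · exact h.2
  · refine ⟨⟨⟨fun w => (ofLex w).1, rfl⟩, fun _ _ => rfl⟩, fun w hw hpos => ?_⟩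
    change 0 < (ofLex w).1
    rcases Prod.Lex.lt_iff.1 hpos with h | ⟨h, h'⟩
    · exact h
    · change 0 = (ofLex w).1 at h
      change 0 < (ofLex w).2 at h'
      rw [weightDet, ← h, mul_zero, sub_zero] at hw
      rcases mul_eq_zero.1 hw with h3 | h3
      · exact absurd h3 h1
      · omega

namespace IsLeading

variable (H : IsLeading Lt)

include H

theorem inv {p : Q} {w : Weight} {c : ℂ} (hc : c ≠ 0) (h : Lt p w c) : Lt p⁻¹ (-w) c⁻¹ := by
  refine H.cancel_left hc h ?_
  rw [mul_inv_cancel₀ (H.ne_zero hc h), mul_inv_cancel₀ hc, add_neg_cancel]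
  exact H.one

/-- If the leading weight is 0, subtracting the leading scalar makes it negative and leaves the
centralizer unchanged. -/
theorem exists_lead_ne_zero {b : Q} (hb : ∀ c : ℂ, b ≠ algebraMap ℂ Q c) :
    ∃ b' v c, c ≠ 0 ∧ v ≠ 0 ∧ Lt b' v c ∧ ∀ u, u * b' = b' * u ↔ u * b = b * u := by
  have hb0 : b ≠ 0 := by simpa using hb 0
  obtain ⟨v, c, hc, hv⟩ := H.exists_lead hb0
  by_cases hv0 : v = 0
  · subst hv0
    have h1 : Lt (b - c • 1) 0 0 := by
      simpa using H.sub hv (H.smul c H.one)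
    have h2 : b - c • 1 ≠ 0 := by
      rw [sub_ne_zero, ← Algebra.algebraMap_eq_smul_one]; exact hb c
    obtain ⟨w, d, hd, hw⟩ := H.exists_lead h2
    refine ⟨_, w, d, hd, (H.lt_of_zero hd hw h1).ne, hw, fun u => ?_⟩
    rw [mul_sub, sub_mul, mul_smul_comm, smul_mul_assoc, mul_one, one_mul, sub_left_inj]
  · exact ⟨b, v, c, hc, hv0, hv, fun u => Iff.rfl⟩

theorem zpow_lead {u : Q} {w : Weight} {c : ℂ} (hc : c ≠ 0) (h : Lt u w c) (k : ℤ) :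
    ∃ d, d ≠ 0 ∧ Lt (u ^ k) (k • w) d := by
  have hpow : ∀ k : ℕ, Lt (u ^ k) (k • w) (c ^ k) := by
    intro k
    induction k with
    | zero => simpa using H.one
    | succ k ih => rw [pow_succ, pow_succ, succ_nsmul]; exact H.mul ih h
  rcases Int.eq_nat_or_neg k with ⟨n, rfl | rfl⟩
  · exact ⟨c ^ n, pow_ne_zero _ hc, by simpa using hpow n⟩
  · refine ⟨(c ^ n)⁻¹, inv_ne_zero (pow_ne_zero _ hc), ?_⟩
    rw [zpow_neg, neg_smul]
    exact H.inv (pow_ne_zero _ hc) (by simpa using hpow n)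

/-- The centralizer of an element that is not a scalar is commutative. -/
theorem commute_of_commute (hcomm : ∀ p q, CommLeading Lt p q) {b : Q}
    (hb : ∀ c : ℂ, b ≠ algebraMap ℂ Q c) {p q : Q} (hp : p * b = b * p) (hq : q * b = b * q) :
    p * q = q * p := by
  obtain ⟨b', v, c, hc, hv0, hv, hiff⟩ := H.exists_lead_ne_zero hb
  rw [← hiff] at hp hq
  clear hiff hb
  obtain ⟨φ, hφ⟩ := exists_weight_hom hv0
  have line : ∀ {u w d}, u * b' = b' * u → d ≠ 0 → Lt u w d → weightDet v w = 0 := by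
    intro u w d hu hd hw
    have h1 := hcomm b' u hv hw
    rw [hu, sub_self, H.zero_iff] at h1
    have h2 := (mul_eq_zero.1 h1).resolve_right (mul_ne_zero hc hd)
    exact_mod_cast h2
  have det_sub : ∀ w w', weightDet v w = 0 → weightDet v w' = 0 → weightDet v (w - w') = 0 := by
    intro w w' h h'
    have := weightDet_add_right v (w - w') w'
    rw [sub_add_cancel, h, h'] at this
    omega
  have mono : ∀ w w', weightDet v w = 0 → weightDet v w' = 0 → w < w' → φ w < φ w' := by
    intro w w' h h' hlt
    have := hφ _ (det_sub _ _ h' h) (sub_pos.2 hlt)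
    rwa [map_sub, sub_pos] at this
  have inj : ∀ w w', weightDet v w = 0 → weightDet v w' = 0 → φ w = φ w' → w = w' := by
    intro w w' h h' heq
    rcases lt_trichotomy w w' with hlt | h0 | hgt
    · exact absurd heq (mono _ _ h h' hlt).ne
    · exact h0
    · exact absurd heq (mono _ _ h' h hgt).ne'
  -- The value group of the centralizer of b' under φ. It is cyclic, and u below realizes a
  -- generator.
  let V : AddSubgroup ℤ :=
    { carrier := {k | ∃ u w d, u * b' = b' * u ∧ d ≠ 0 ∧ Lt u w d ∧ φ w = k}
      zero_mem' := ⟨1, 0, 1, by simp, one_ne_zero, H.one, map_zero φ⟩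
      add_mem' := by
        rintro _ _ ⟨u, w, d, hu, hd, hw, rfl⟩ ⟨u', w', d', hu', hd', hw', rfl⟩
        refine ⟨u * u', w + w', d * d', ?_, mul_ne_zero hd hd', H.mul hw hw', map_add φ _ _⟩
        rw [mul_assoc, hu', ← mul_assoc, hu, mul_assoc]
      neg_mem' := by
        rintro _ ⟨u, w, d, hu, hd, hw, rfl⟩
        exact ⟨u⁻¹, -w, d⁻¹, (Commute.inv_left₀ hu).eq, inv_ne_zero hd, H.inv hd hw,
          map_neg φ _⟩ }
  obtain ⟨m, hm⟩ := Int.subgroup_cyclic V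
  have hmem : ∀ j, j ∈ V ↔ m ∣ j := by
    intro j
    rw [hm, ← AddSubgroup.zmultiples_eq_closure, Int.mem_zmultiples_iff]
  obtain ⟨u, w₀, d₀, hu, hd₀, hw₀, hφ₀⟩ : m ∈ V := (hmem m).2 dvd_rfl
  -- Some scalar multiple of a power of u has the same leading term as r, and subtracting it lowers
  -- φ. Such multiples commute with whatever commutes with u.
  have step : ∀ {r w d}, r * b' = b' * r → d ≠ 0 → Lt r w d →
      ∃ e, (∀ x, x * u = u * x → x * e = e * x) ∧
        (r - e = 0 ∨ ∃ w' d', d' ≠ 0 ∧ Lt (r - e) w' d' ∧ φ w' < φ w) := by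
    intro r w d hr hd hw
    obtain ⟨k, hk⟩ := (hmem _).1 ⟨r, w, d, hr, hd, hw, rfl⟩
    obtain ⟨d₁, hd₁, hu₁⟩ := H.zpow_lead hd₀ hw₀ k
    have hcom : ∀ x, x * u = u * x → x * ((d / d₁) • u ^ k) = ((d / d₁) • u ^ k) * x := by
      intro x hx
      rw [mul_smul_comm, smul_mul_assoc, (Commute.zpow_right₀ hx k).eq]
    have hub : u ^ k * b' = b' * u ^ k := (Commute.zpow_left₀ hu k).eq
    have hweq : k • w₀ = w := by
      refine inj _ _ (line hub hd₁ hu₁) (line hr hd hw) ?_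
      rw [map_zsmul, hφ₀, hk, smul_eq_mul, mul_comm]
    rw [hweq] at hu₁
    refine ⟨(d / d₁) • u ^ k, hcom, or_iff_not_imp_left.2 fun hne => ?_⟩
    have hlow := H.sub hw (H.smul (d / d₁) hu₁)
    rw [div_mul_cancel₀ _ hd₁, sub_self] at hlow
    obtain ⟨w', d', hd', hw'⟩ := H.exists_lead hne
    refine ⟨w', d', hd', hw', mono _ _ (line ?_ hd' hw') (line hr hd hw)
      (H.lt_of_zero hd' hw' hlow)⟩
    rw [sub_mul, mul_sub, hr, ← hcom b' hu.symm]
  have approx : ∀ {r} (N : ℕ), r * b' = b' * r → ∀ {w d}, d ≠ 0 → Lt r w d →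
      ∃ e, (∀ x, x * u = u * x → x * e = e * x) ∧
        (r - e = 0 ∨ ∃ w' d', d' ≠ 0 ∧ Lt (r - e) w' d' ∧ φ w' + N ≤ φ w) := by
    intro r N
    induction N with
    | zero =>
      intro hr w d hd hw
      exact ⟨0, by simp, Or.inr ⟨w, d, hd, by simpa using hw, by simp⟩⟩
    | succ N ih =>
      intro hr w d hd hw
      obtain ⟨e, he, h0 | ⟨w', d', hd', hw', hle⟩⟩ := ih hr hd hw
      · exact ⟨e, he, Or.inl h0⟩
      obtain ⟨e', he', h⟩ := step (by rw [sub_mul, mul_sub, hr, ← he b' hu.symm]) hd' hw'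
      refine ⟨e + e', fun x hx => by rw [mul_add, add_mul, he x hx, he' x hx], ?_⟩
      rw [← sub_sub]
      refine h.imp_right ?_
      rintro ⟨w'', d'', hd'', hw'', hlt⟩
      exact ⟨w'', d'', hd'', hw'', by push_cast; omega⟩
  have main : ∀ {r x}, r * b' = b' * r → x * b' = b' * x → x * u = u * x → r * x = x * r := by
    intro r x hr hx hxu
    by_contra hne
    have hne' : r * x - x * r ≠ 0 := sub_ne_zero.2 hne
    have hr0 : r ≠ 0 := by rintro rfl; simp at hne
    have hx0 : x ≠ 0 := by rintro rfl; simp at hne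
    obtain ⟨w, d, hd, hw⟩ := H.exists_lead hr0
    obtain ⟨w₁, d₁, hd₁, hw₁⟩ := H.exists_lead hx0
    obtain ⟨w₂, d₂, hd₂, hw₂⟩ := H.exists_lead hne'
    -- Since x commutes with e, [r, x] = [r − e, x]. The number of steps makes the φ-value of this
    -- bracket drop below that of its assumed leading term.
    obtain ⟨e, he, h⟩ := approx (φ w + φ w₁ - φ w₂).toNat hr hd hw
    have hbr : r * x - x * r = (r - e) * x - x * (r - e) := by
      rw [sub_mul, mul_sub, he x hxu]; abel
    rcases h with h | ⟨w', d', hd', hw', hle⟩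
    · rw [h] at hbr
      exact hne' (by simpa using hbr)
    · have h1 := H.sub (H.mul hw' hw₁) (add_comm w₁ w' ▸ H.mul hw₁ hw')
      rw [← hbr, mul_comm d₁ d', sub_self] at h1
      have h2 := H.lt_of_zero hd₂ hw₂ h1
      have hreb : (r - e) * b' = b' * (r - e) := by rw [sub_mul, mul_sub, hr, ← he b' hu.symm]
      have hrx : r * x * b' = b' * (r * x) := by rw [mul_assoc, hx, ← mul_assoc, hr, mul_assoc]
      have hxr : x * r * b' = b' * (x * r) := by rw [mul_assoc, hr, ← mul_assoc, hx, mul_assoc]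
      have h3 := mono _ _ (line (by rw [sub_mul, mul_sub, hrx, hxr]) hd₂ hw₂) (by
        rw [weightDet_add_right, line hreb hd' hw', line hx hd₁ hw₁, add_zero]) h2
      rw [map_add] at h3
      omega
  -- The inner use shows that q commutes with u; the outer one then applies to p and q.
  exact main hp hq (main hq hu rfl)

end IsLeading

end Centralizer

end Leading

/-! ### Leading terms in the Weyl algebra and its skew field of fractions -/

section Weyl

/-- The operator on `ℂ[z]` that multiplies by a polynomial. -/
noncomputable abbrev opMul (f : ℂ[X]) : Module.End ℂ ℂ[X] := LinearMap.mulLeft ℂ f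

theorem adRight_opZ_eq_zero_iff {T : Module.End ℂ ℂ[X]} :
    adRight opZ T = 0 ↔ ∃ f, T = opMul f := by
  constructor
  · intro h
    refine ⟨T 1, LinearMap.ext fun g => ?_⟩
    rw [eq_mulLeft_of_adZ_eq_zero h, LinearMap.mulLeft_apply, mul_comm]
  · rintro ⟨f, rfl⟩
    rw [adRight_apply, sub_eq_zero]
    refine LinearMap.ext fun g => ?_
    simp [opZ, mul_left_comm]

theorem hasSlice_opD : HasSlice opZ opD where
  slice := by rw [adRight_apply, opD_mul_opZ]; abel
  comm := by
    intro p q hp hq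
    obtain ⟨f, rfl⟩ := adRight_opZ_eq_zero_iff.1 hp
    obtain ⟨g, rfl⟩ := adRight_opZ_eq_zero_iff.1 hq
    refine LinearMap.ext fun h => ?_
    simp only [Module.End.mul_apply, LinearMap.mulLeft_apply]
    ring

theorem opD_commutator_opMul (f : ℂ[X]) :
    opD * opMul f - opMul f * opD = opMul (derivative f) := by
  refine LinearMap.ext fun g => ?_
  simp [opD, derivative_mul]

/-- The last nonzero iterated commutator with z commutes with z, hence is multiplication by a
polynomial: n! times the coefficient of the top power of ∂. -/
theorem exists_isSymbol {T : Module.End ℂ ℂ[X]} (hT : T ∈ weylSubalgebra) (hT0 : T ≠ 0) :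
    ∃ n f, f ≠ 0 ∧ IsSymbol opZ T n (opMul f) := by
  classical
  have h := weyl_adZ_nilpotent hT
  set n := Nat.find h with hn
  have h1 : (adZ ^ (n + 1)) T = 0 := Nat.find_spec h
  have h2 : (adZ ^ n) T ≠ 0 := by
    rcases hk : n with _ | k
    · simpa using hT0
    · exact Nat.find_min h (by omega)
  obtain ⟨f, hf⟩ := adRight_opZ_eq_zero_iff (T := (adZ ^ n) T).1 (by
    rw [pow_succ', Module.End.mul_apply] at h1; exact h1)
  have hfac : (n.factorial : ℂ) ≠ 0 := by exact_mod_cast n.factorial_ne_zero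
  refine ⟨n, (n.factorial : ℂ)⁻¹ • f, smul_ne_zero (inv_ne_zero hfac) ?_,
    adRight_opZ_eq_zero_iff.2 ⟨_, rfl⟩, ?_⟩
  · rintro rfl
    exact h2 (by rw [hf]; ext1; simp)
  · change (adZ ^ n) T = _
    rw [hf]
    refine LinearMap.ext fun g => ?_
    simp [smul_smul, hfac]

theorem IsSymbol.mul_opMul {T S : Module.End ℂ ℂ[X]} {n m : ℕ} {f g : ℂ[X]}
    (hT : IsSymbol opZ T n (opMul f)) (hS : IsSymbol opZ S m (opMul g)) :
    IsSymbol opZ (T * S) (n + m) (opMul (f * g)) := by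
  refine ⟨adRight_opZ_eq_zero_iff.2 ⟨_, rfl⟩, ?_⟩
  have top : ∀ {T : Module.End ℂ ℂ[X]} {n : ℕ} {f : ℂ[X]}, IsSymbol opZ T n (opMul f) →
      (adZ ^ (n + 1)) T = 0 := by
    intro T n f h
    rw [pow_succ', Module.End.mul_apply]
    change adRight opZ ((adRight opZ ^ n) T) = 0
    rw [h.2, map_smul, h.1, smul_zero]
  have h := (adZ_iterate_mul _ n m rfl T S (top hT) (top hS)).1
  change (adRight opZ ^ (n + m)) (T * S)
    = ((n + m).choose n : ℂ) • ((adRight opZ ^ n) T * (adRight opZ ^ m) S) at h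
  rw [h, hT.2, hS.2, smul_mul_smul_comm, smul_smul,
    show opMul f * opMul g = opMul (f * g) from
      LinearMap.ext fun p => by simp]
  have h3 := Nat.add_choose_mul_factorial_mul_factorial n m
  rw [← Nat.choose_symm_add] at h3
  congr 1
  rw [← mul_assoc]
  exact_mod_cast h3

/-- The coefficient of weight `(n, i)`, i.e. of `z ^ i * ∂ ^ n`, of an operator. -/
noncomputable def opCoeff (w : Weight) : Module.End ℂ ℂ[X] →ₗ[ℂ] ℂ :=
  if 0 ≤ (ofLex w).1 ∧ 0 ≤ (ofLex w).2 then
    ((ofLex w).1.toNat.factorial : ℂ)⁻¹ •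
      (lcoeff ℂ (ofLex w).2.toNat ∘ₗ LinearMap.applyₗ 1 ∘ₗ (adRight opZ ^ (ofLex w).1.toNat))
  else 0

/-- The n-fold commutator with z kills orders below n and sends z^i ∂^n to n! z^i; higher orders
keep a positive power of ∂, which evaluation at 1 removes. -/
theorem opCoeff_natCast (n i : ℕ) (T : Module.End ℂ ℂ[X]) :
    opCoeff (toLex ((n : ℤ), (i : ℤ))) T
      = (n.factorial : ℂ)⁻¹ * (((adRight opZ ^ n) T) 1).coeff i := by
  simp [opCoeff]

/-- The leading term relation of operators. -/
def opLeading (T : Module.End ℂ ℂ[X]) (w : Weight) (c : ℂ) : Prop :=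
  (∀ w', w < w' → opCoeff w' T = 0) ∧ opCoeff w T = c

/-- The z-degree i is an integer because the expected degree for a commutator is −1 when both
symbols are constant; `hneg` covers that case. -/
theorem opLeading_of_isSymbol {T : Module.End ℂ ℂ[X]} {n : ℕ} {f : ℂ[X]}
    (h : IsSymbol opZ T n (opMul f)) {i : ℤ} {c : ℂ} (hf : ∀ j : ℕ, i < j → f.coeff j = 0)
    (hneg : i < 0 → c = 0) (hpos : ∀ j : ℕ, i = j → f.coeff j = c) :
    opLeading T (toLex ((n : ℤ), i)) c := by
  have hn : ∀ j : ℕ, opCoeff (toLex ((n : ℤ), (j : ℤ))) T = f.coeff j := by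
    intro j
    have hfac : (n.factorial : ℂ) ≠ 0 := by exact_mod_cast n.factorial_ne_zero
    rw [opCoeff_natCast, h.2]
    simp [hfac]
  have hneg' : ∀ w : Weight, ¬ (0 ≤ (ofLex w).1 ∧ 0 ≤ (ofLex w).2) → opCoeff w T = 0 := by
    intro w hw
    rw [opCoeff, if_neg hw, LinearMap.zero_apply]
  constructor
  · intro w hw
    obtain ⟨⟨k, j⟩, rfl⟩ := toLex.surjective w
    by_cases hkj : 0 ≤ k ∧ 0 ≤ j
    · obtain ⟨hk, hj⟩ := hkj
      lift k to ℕ using hk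
      lift j to ℕ using hj
      rcases Prod.Lex.lt_iff.1 hw with h1 | ⟨h1, h2⟩
      · change (n : ℤ) < k at h1
        obtain ⟨m, rfl⟩ : ∃ m, k = m + 1 + n := ⟨k - n - 1, by omega⟩
        rw [opCoeff_natCast, pow_add, Module.End.mul_apply, h.2, map_smul, pow_succ,
          Module.End.mul_apply, h.1]
        simp
      · change (n : ℤ) = k at h1
        rw [← h1, hn]
        exact hf j h2
    · exact hneg' _ hkj
  · by_cases hi : 0 ≤ i
    · lift i to ℕ using hi
      rw [hn, hpos i rfl]
    · rw [hneg (by omega), hneg']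
      exact fun h => hi h.2

theorem opLeading_lead {T : Module.End ℂ ℂ[X]} {n : ℕ} {f : ℂ[X]}
    (h : IsSymbol opZ T n (opMul f)) :
    opLeading T (toLex ((n : ℤ), (f.natDegree : ℤ))) f.leadingCoeff := by
  refine opLeading_of_isSymbol h ?_ (fun h => by omega) ?_
  · intro j hj
    exact coeff_eq_zero_of_natDegree_lt (by exact_mod_cast hj)
  · intro j hj
    rw [← Nat.cast_inj.1 hj, leadingCoeff]

theorem opLeading_zero (w : Weight) (c : ℂ) : opLeading 0 w c ↔ c = 0 := by
  simp [opLeading, eq_comm]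

theorem opLeading_lower {T : Module.End ℂ ℂ[X]} {v w : Weight} {c : ℂ} (h : opLeading T v c)
    (hlt : v < w) : opLeading T w 0 :=
  ⟨fun w' hw' => h.1 w' (hlt.trans hw'), h.1 w hlt⟩

theorem opLeading_cases {T : Module.End ℂ ℂ[X]} {v w : Weight} {c d : ℂ} (hc : c ≠ 0)
    (h : opLeading T v c) (h' : opLeading T w d) : (w = v ∧ d = c) ∨ (v < w ∧ d = 0) := by
  rcases lt_trichotomy v w with hlt | rfl | hgt
  · exact Or.inr ⟨hlt, by rw [← h'.2, h.1 w hlt]⟩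
  · exact Or.inl ⟨rfl, by rw [← h'.2, h.2]⟩
  · exact absurd (by rw [← h.2, h'.1 v hgt]) hc

theorem opLeading_mul {T S : Module.End ℂ ℂ[X]} (hT : T ∈ weylSubalgebra)
    (hS : S ∈ weylSubalgebra) {v w : Weight} {c d : ℂ} (h : opLeading T v c)
    (h' : opLeading S w d) : opLeading (T * S) (v + w) (c * d) := by
  by_cases hT0 : T = 0
  · subst hT0
    rw [(opLeading_zero _ _).1 h, zero_mul, zero_mul, opLeading_zero]
  by_cases hS0 : S = 0
  · subst hS0
    rw [(opLeading_zero _ _).1 h', mul_zero, mul_zero, opLeading_zero]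
  obtain ⟨n, f, hf, hn⟩ := exists_isSymbol hT hT0
  obtain ⟨m, g, hg, hm⟩ := exists_isSymbol hS hS0
  have key := opLeading_lead (hn.mul_opMul hm)
  rw [natDegree_mul hf hg, leadingCoeff_mul, Nat.cast_add, Nat.cast_add,
    show toLex ((n : ℤ) + m, (f.natDegree : ℤ) + g.natDegree)
      = toLex ((n : ℤ), (f.natDegree : ℤ)) + toLex ((m : ℤ), (g.natDegree : ℤ)) from rfl] at key
  rcases opLeading_cases (leadingCoeff_ne_zero.2 hf) (opLeading_lead hn) h with
    ⟨rfl, rfl⟩ | ⟨h1, rfl⟩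
  · rcases opLeading_cases (leadingCoeff_ne_zero.2 hg) (opLeading_lead hm) h' with
      ⟨rfl, rfl⟩ | ⟨h2, rfl⟩
    · exact key
    · rw [mul_zero]
      exact opLeading_lower key (add_lt_add_right h2 _)
  · rw [zero_mul]
    refine opLeading_lower key (add_lt_add_of_lt_of_le h1 ?_)
    rcases opLeading_cases (leadingCoeff_ne_zero.2 hg) (opLeading_lead hm) h' with h2 | h2
    · exact h2.1.ge
    · exact h2.1.le

/-- The commutator has symbol n f g' − m g f', whose coefficient in degree deg f + deg g − 1 is (n
deg g − m deg f) times the product of the leading coefficients: the alternating form. -/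
theorem opLeading_commutator_of_isSymbol {T S : Module.End ℂ ℂ[X]} {n m : ℕ} {f g : ℂ[X]}
    (hn : IsSymbol opZ T n (opMul f)) (hm : IsSymbol opZ S m (opMul g)) :
    opLeading (T * S - S * T)
      (toLex ((n : ℤ), (f.natDegree : ℤ)) + toLex ((m : ℤ), (g.natDegree : ℤ)) - weightShift)
      (weightDet (toLex ((n : ℤ), (f.natDegree : ℤ))) (toLex ((m : ℤ), (g.natDegree : ℤ))) *
        (f.leadingCoeff * g.leadingCoeff)) := by
  rcases hN : n + m with _ | N
  · obtain ⟨rfl, rfl⟩ : n = 0 ∧ m = 0 := by omega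
    have e1 : T = opMul f := by simpa using hn.2
    have e2 : S = opMul g := by simpa using hm.2
    rw [e1, e2, hasSlice_opD.comm _ _ (adRight_opZ_eq_zero_iff.2 ⟨f, rfl⟩)
      (adRight_opZ_eq_zero_iff.2 ⟨g, rfl⟩), sub_self, opLeading_zero]
    simp [weightDet]
  have h := hasSlice_opD.isSymbol_commutator N hN hn hm
  rw [opD_commutator_opMul, opD_commutator_opMul] at h
  have e : (n : ℂ) • (opMul f * opMul (derivative g)) - (m : ℂ) • (opMul g * opMul (derivative f))
      = opMul ((n : ℂ) • (f * derivative g) - (m : ℂ) • (g * derivative f)) := by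
    refine LinearMap.ext fun p => ?_
    simp [sub_mul, mul_assoc]
  rw [e] at h
  have hw : toLex ((n : ℤ), (f.natDegree : ℤ)) + toLex ((m : ℤ), (g.natDegree : ℤ)) - weightShift
      = toLex ((N : ℤ), (f.natDegree + g.natDegree - 1 : ℤ)) := by
    refine toLex.symm.injective (Prod.ext ?_ rfl)
    change (n : ℤ) + m - 1 = N
    omega
  rw [hw]
  have coeff_top : ∀ (p q : ℂ[X]) (k : ℕ), p.natDegree + q.natDegree ≤ k + 1 →
      (p * derivative q).coeff k
        = if p.natDegree + q.natDegree = k + 1 then q.natDegree * (p.leadingCoeff * q.leadingCoeff)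
          else 0 := by
    intro p q k hk
    rcases hq : q.natDegree with _ | l
    · rw [natDegree_eq_zero] at hq
      obtain ⟨a, rfl⟩ := hq
      simp
    rw [hq] at hk
    have hd : (derivative q).natDegree ≤ l := by
      have := natDegree_derivative_le q
      omega
    split_ifs with h
    · obtain rfl : k = p.natDegree + l := by omega
      rw [coeff_mul_add_eq_of_natDegree_le le_rfl hd, coeff_derivative, leadingCoeff,
        leadingCoeff, hq]
      push_cast
      ring
    · refine coeff_eq_zero_of_natDegree_lt (natDegree_mul_le.trans_lt ?_)
      omega
  refine opLeading_of_isSymbol h ?_ ?_ ?_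
  · intro j hj
    rw [coeff_sub, coeff_smul, coeff_smul, coeff_top _ _ _ (by omega), coeff_top _ _ _ (by omega),
      if_neg (by omega), if_neg (by omega)]
    simp
  · intro hneg
    have h1 : f.natDegree = 0 := by omega
    have h2 : g.natDegree = 0 := by omega
    simp [weightDet, h1, h2]
  · intro j hj
    rw [coeff_sub, coeff_smul, coeff_smul, coeff_top _ _ _ (by omega), coeff_top _ _ _ (by omega),
      if_pos (by omega), if_pos (by omega)]
    simp only [weightDet, ofLex_toLex, smul_eq_mul]
    push_cast
    ring

theorem opLeading_commutator {T S : Module.End ℂ ℂ[X]} (hT : T ∈ weylSubalgebra)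
    (hS : S ∈ weylSubalgebra) {v w : Weight} {c d : ℂ} (h : opLeading T v c)
    (h' : opLeading S w d) :
    opLeading (T * S - S * T) (v + w - weightShift) (weightDet v w * (c * d)) := by
  by_cases hT0 : T = 0
  · subst hT0
    rw [(opLeading_zero _ _).1 h, zero_mul, mul_zero, sub_zero, zero_mul, mul_zero, opLeading_zero]
  by_cases hS0 : S = 0
  · subst hS0
    rw [(opLeading_zero _ _).1 h', zero_mul, mul_zero, mul_zero, sub_zero, mul_zero,
      opLeading_zero]
  obtain ⟨n, f, hf, hn⟩ := exists_isSymbol hT hT0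
  obtain ⟨m, g, hg, hm⟩ := exists_isSymbol hS hS0
  have key := opLeading_commutator_of_isSymbol hn hm
  rcases opLeading_cases (leadingCoeff_ne_zero.2 hf) (opLeading_lead hn) h with
    ⟨rfl, rfl⟩ | ⟨h1, rfl⟩
  · rcases opLeading_cases (leadingCoeff_ne_zero.2 hg) (opLeading_lead hm) h' with
      ⟨rfl, rfl⟩ | ⟨h2, rfl⟩
    · exact key
    · rw [mul_zero, mul_zero]
      exact opLeading_lower key (sub_lt_sub_right (add_lt_add_right h2 _) _)
  · rw [zero_mul, mul_zero]
    refine opLeading_lower key (sub_lt_sub_right (add_lt_add_of_lt_of_le h1 ?_) _)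
    rcases opLeading_cases (leadingCoeff_ne_zero.2 hg) (opLeading_lead hm) h' with h2 | h2
    · exact h2.1.ge
    · exact h2.1.le

/-- The leading term relation of the Weyl algebra. -/
def weylLeading (T : WeylAlgebra) (w : Weight) (c : ℂ) : Prop := opLeading T.1 w c

theorem isLeading_weylLeading : IsLeading weylLeading where
  add := by
    intro p q w c d hp hq
    refine ⟨fun w' hw' => ?_, ?_⟩
    · change opCoeff w' (p.1 + q.1) = 0
      rw [map_add, hp.1 w' hw', hq.1 w' hw', add_zero]
    · change opCoeff w (p.1 + q.1) = _
      rw [map_add, hp.2, hq.2]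
  mul := fun {p q} _ _ _ _ hp hq => opLeading_mul p.2 q.2 hp hq
  lower := fun h hlt => opLeading_lower h hlt
  zero_iff := opLeading_zero _ _
  one := by
    have h : IsSymbol opZ 1 0 (opMul 1) :=
      ⟨adRight_opZ_eq_zero_iff.2 ⟨1, rfl⟩, by simp [Module.End.one_eq_id]⟩
    have := opLeading_lead h
    rw [natDegree_one, leadingCoeff_one] at this
    exact this
  smul := by
    intro p w c a hp
    refine ⟨fun w' hw' => ?_, ?_⟩
    · change opCoeff w' (a • p.1) = 0
      rw [map_smul, hp.1 w' hw', smul_zero]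
    · change opCoeff w (a • p.1) = _
      rw [map_smul, hp.2, smul_eq_mul]
  exists_lead := by
    intro p hp
    obtain ⟨n, f, hf, hn⟩ := exists_isSymbol p.2 (fun h => hp (Subtype.ext h))
    exact ⟨_, _, leadingCoeff_ne_zero.2 hf, opLeading_lead hn⟩

theorem commLeading_weylLeading (p q : WeylAlgebra) : CommLeading weylLeading p q :=
  fun _ _ _ _ hp hq => opLeading_commutator p.2 q.2 hp hq

/-- The inclusion of the Weyl algebra into its skew field of fractions. -/
noncomputable def weylInclusion : WeylAlgebra →ₐ[ℂ] WeylField :=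
  { (OreLocalization.numeratorRingHom : WeylAlgebra →+* WeylField) with
    commutes' := fun _ => rfl }

theorem weylInclusion_injective : Function.Injective weylInclusion :=
  OreLocalization.numeratorHom_inj fun _ hx => hx.1

theorem weylField_frac (q : WeylField) :
    ∃ s r : WeylAlgebra, s ≠ 0 ∧ weylInclusion s * q = weylInclusion r := by
  induction q using OreLocalization.ind with
  | _ r s =>
    refine ⟨s, r, nonZeroDivisors.ne_zero s.2, ?_⟩
    exact OreLocalization.mul_cancel

/-- Centralizers of elements of the Weyl skew field that are not scalars are commutative. -/
theorem weylField_commute {b : WeylField} (hb : ∀ c : ℂ, b ≠ algebraMap ℂ WeylField c)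
    {p q : WeylField} (hp : p * b = b * p) (hq : q * b = b * q) : p * q = q * p :=
  (isLeading_extendLeading weylInclusion_injective weylField_frac
    isLeading_weylLeading).commute_of_commute
    (commLeading_extendLeading weylInclusion_injective weylField_frac isLeading_weylLeading
      commLeading_weylLeading) hb hp hq

theorem weylField_not_commutative : ∃ p q : WeylField, p * q ≠ q * p := by
  let z : WeylAlgebra := ⟨opZ, Algebra.subset_adjoin (by simp)⟩
  let d : WeylAlgebra := ⟨opD, Algebra.subset_adjoin (by simp)⟩
  refine ⟨weylInclusion d, weylInclusion z, fun h => ?_⟩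
  rw [← map_mul, ← map_mul] at h
  have h1 := congrArg Subtype.val (weylInclusion_injective h)
  change opD * opZ = opZ * opD at h1
  rw [opD_mul_opZ] at h1
  exact one_ne_zero (add_eq_left.1 h1)

end Weyl

/-! ### Subalgebras of a polynomial ring and their integral closure -/

section Normalization

variable {K : Type*} [Field K] [Algebra ℂ K]

theorem exists_algebraMap_eq_of_isAlgebraic {k : K} (hk : IsAlgebraic ℂ k) :
    ∃ c : ℂ, k = algebraMap ℂ K c := by
  have : Algebra.IsIntegral ℂ (Algebra.adjoin ℂ {k}) :=
    Algebra.IsIntegral.adjoin fun y hy => by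
      rw [Set.mem_singleton_iff] at hy
      exact hy ▸ hk.isIntegral
  obtain ⟨c, hc⟩ := (IsAlgClosed.algebraMap_bijective_of_isIntegral (k := ℂ)).2
    (⟨k, Algebra.self_mem_adjoin_singleton ℂ k⟩ : Algebra.adjoin ℂ {k})
  exact ⟨c, (congrArg Subtype.val hc).symm⟩

theorem transcendental_of_adjoin {x β : K} (hβ : ∀ c : ℂ, β ≠ algebraMap ℂ K c)
    (hx : β ∈ Algebra.adjoin ℂ {x}) : Transcendental ℂ x := by
  intro halg
  obtain ⟨c, rfl⟩ := exists_algebraMap_eq_of_isAlgebraic halg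
  rw [Algebra.adjoin_singleton_algebraMap, Algebra.mem_bot] at hx
  obtain ⟨d, hd⟩ := hx
  exact hβ d hd.symm

theorem isIntegrallyClosed_adjoin {x : K} (hx : Transcendental ℂ x) :
    IsIntegrallyClosed (Algebra.adjoin ℂ {x}) :=
  IsIntegrallyClosed.of_equiv (Polynomial.algEquivOfTranscendental ℂ x hx).toRingEquiv

/-- The integral closure of a subalgebra of `ℂ[x]` in a field that contains `x`, if that field is the
field of fractions of the subalgebra. -/
theorem isIntegral_iff_mem_adjoin {B : Subalgebra ℂ K} {x β : K}
    (hB : B ≤ Algebra.adjoin ℂ {x}) (hfrac : ∀ k : K, ∃ a ∈ B, ∃ b ∈ B, k = a / b)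
    (hβB : β ∈ B) (hβ : ∀ c : ℂ, β ≠ algebraMap ℂ K c) (k : K) :
    IsIntegral B k ↔ k ∈ Algebra.adjoin ℂ {x} := by
  have hx := transcendental_of_adjoin hβ (hB hβB)
  constructor
  · rintro ⟨p, hp, hpk⟩
    have := isIntegrallyClosed_adjoin hx
    have : IsFractionRing (Algebra.adjoin ℂ {x}) K := IsFractionRing.of_field _ _ fun k => by
      -- Fractions of elements of B are fractions of elements of ℂ[x], so K is also the fraction
      -- field of ℂ[x].
      obtain ⟨a, ha, b, hb, rfl⟩ := hfrac k
      exact ⟨⟨a, hB ha⟩, ⟨b, hB hb⟩, rfl⟩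
    have hint : IsIntegral (Algebra.adjoin ℂ {x}) k := by
      refine ⟨p.map (Subalgebra.inclusion hB).toRingHom, hp.map _, ?_⟩
      rw [eval₂_map]
      exact hpk
    obtain ⟨y, hy⟩ := IsIntegrallyClosed.isIntegral_iff.1 hint
    rw [← hy]
    exact y.2
  · intro hk
    have hxint : IsIntegral B x := by
      have h1 := hB hβB
      rw [Algebra.adjoin_singleton_eq_range_aeval] at h1
      obtain ⟨P, hP⟩ := h1
      have hdeg : P.natDegree ≠ 0 := by
        intro h0
        obtain ⟨c, rfl⟩ := natDegree_eq_zero.1 h0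
        exact hβ c (by rw [← hP]; simp)
      have hP0 : P ≠ 0 := by rintro rfl; simp at hdeg
      have hlc : P.leadingCoeff⁻¹ ≠ 0 := inv_ne_zero (leadingCoeff_ne_zero.2 hP0)
      -- The monic polynomial P / lc(P), of positive degree, takes at x the value β / lc(P), which
      -- lies in B.
      refine IsIntegral.of_aeval_monic
        (p := (P * C P.leadingCoeff⁻¹).map (algebraMap ℂ B))
        ((monic_mul_leadingCoeff_inv hP0).map _) ?_ ?_
      · rw [natDegree_map, natDegree_mul_C hlc]
        exact hdeg
      · rw [aeval_map_algebraMap, map_mul, aeval_C]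
        have : aeval x P * algebraMap ℂ K P.leadingCoeff⁻¹ ∈ B :=
          B.mul_mem (by rw [show aeval x P = β from hP]; exact hβB) (B.algebraMap_mem _)
        exact isIntegral_algebraMap (R := B) (x := ⟨_, this⟩)
    have hle : Algebra.adjoin ℂ {x} ≤ (integralClosure B K).restrictScalars ℂ := by
      rw [Algebra.adjoin_le_iff, Set.singleton_subset_iff]
      exact hxint
    exact hle hk

end Normalization

/-! ### The field of fractions of a commutative subalgebra of a skew field -/

section FracField

variable {Q : Type*} [DivisionRing Q] [Algebra ℂ Q]

theorem fracSet_commute {B : Subalgebra ℂ Q} (hB : ∀ p ∈ B, ∀ q ∈ B, p * q = q * p) {p q : Q}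
    (hp : p ∈ fracSet B) (hq : q ∈ fracSet B) : p * q = q * p := by
  obtain ⟨a, ha, b, hb, -, rfl⟩ := hp
  obtain ⟨c, hc, d, hd, -, rfl⟩ := hq
  have h1 : Commute (a * b⁻¹) c := Commute.mul_left (hB a ha c hc) (Commute.inv_left₀ (hB b hb c hc))
  have h2 : Commute (a * b⁻¹) d := Commute.mul_left (hB a ha d hd) (Commute.inv_left₀ (hB b hb d hd))
  exact (h1.mul_right h2.inv_right₀).eq

/-- The field of fractions of a commutative subalgebra, as a subfield. -/
def fracSubfield (B : Subalgebra ℂ Q) (hB : ∀ p ∈ B, ∀ q ∈ B, p * q = q * p) : Subfield Q where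
  carrier := fracSet B
  mul_mem' := by
    rintro _ _ ⟨a, ha, b, hb, hb0, rfl⟩ ⟨c, hc, d, hd, hd0, rfl⟩
    refine ⟨a * c, B.mul_mem ha hc, d * b, B.mul_mem hd hb, mul_ne_zero hd0 hb0, ?_⟩
    have h : Commute b⁻¹ c := Commute.inv_left₀ (hB b hb c hc)
    rw [mul_inv_rev, mul_assoc, ← mul_assoc b⁻¹, h.eq]
    simp only [mul_assoc]
  one_mem' := ⟨1, B.one_mem, 1, B.one_mem, one_ne_zero, by simp⟩
  add_mem' := by
    rintro _ _ ⟨a, ha, b, hb, hb0, rfl⟩ ⟨c, hc, d, hd, hd0, rfl⟩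
    refine ⟨a * d + b * c, B.add_mem (B.mul_mem ha hd) (B.mul_mem hb hc), b * d,
      B.mul_mem hb hd, mul_ne_zero hb0 hd0, ?_⟩
    rw [← div_eq_mul_inv, ← div_eq_mul_inv, ← div_eq_mul_inv]
    exact Commute.div_add_div (hB b hb c hc) (hB b hb d hd) hb0 hd0
  zero_mem' := ⟨0, B.zero_mem, 1, B.one_mem, one_ne_zero, by simp⟩
  neg_mem' := by
    rintro _ ⟨a, ha, b, hb, hb0, rfl⟩
    exact ⟨-a, B.neg_mem ha, b, hb, hb0, by simp⟩
  inv_mem' := by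
    rintro _ ⟨a, ha, b, hb, hb0, rfl⟩
    by_cases ha0 : a = 0
    · exact ⟨0, B.zero_mem, 1, B.one_mem, one_ne_zero, by simp [ha0]⟩
    · exact ⟨b, hb, a, ha, ha0, by simp⟩

theorem subset_fracSet (B : Subalgebra ℂ Q) {b : Q} (hb : b ∈ B) : b ∈ fracSet B :=
  ⟨b, hb, 1, B.one_mem, one_ne_zero, by simp⟩

theorem exists_fracField.{u} {Q : Type u} [DivisionRing Q] [Algebra ℂ Q] (B : Subalgebra ℂ Q)
    (hB : ∀ p ∈ B, ∀ q ∈ B, p * q = q * p) :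
    ∃ (K : Type u) (_ : Field K) (_ : Algebra ℂ K) (ι : K →ₐ[ℂ] Q), Set.range ι = fracSet B := by
  let F := fracSubfield B hB
  let fieldF : Field F :=
    { (inferInstance : DivisionRing F) with
      mul_comm := fun p q => Subtype.ext (fracSet_commute hB p.2 q.2) }
  let f : ℂ →+* F := (algebraMap ℂ Q).codRestrict F fun c => subset_fracSet B (B.algebraMap_mem c)
  let algF : Algebra ℂ F := f.toAlgebra
  exact ⟨F, fieldF, algF, { F.subtype with commutes' := fun _ => rfl }, Subtype.range_coe⟩

/-- The coefficients in B lie in the range of the injective ι, so monic equations can be moved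
between the skew field and K. -/
theorem mem_integralClosureSet_iff {K : Type*} [Field K] [Algebra ℂ K] {B : Subalgebra ℂ Q}
    {ι : K →ₐ[ℂ] Q} (hι : Set.range ι = fracSet B) (k : K) :
    ι k ∈ integralClosureSet B ↔ IsIntegral (B.comap ι) k := by
  let φ : B.comap ι →+* Q := (ι : K →+* Q).comp (algebraMap (B.comap ι) K)
  have heval : ∀ q : (B.comap ι)[X],
      (q.map φ).eval (ι k) = ι (q.eval₂ (algebraMap (B.comap ι) K) k) := by
    intro q
    rw [eval_map]
    exact (hom_eval₂ q (algebraMap (B.comap ι) K) (ι : K →+* Q) k).symm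
  constructor
  · rintro ⟨-, p, hp, hcoeff, heq⟩
    have hlift : p ∈ lifts φ := by
      rw [lifts_iff_coeff_lifts]
      intro n
      obtain ⟨a, ha⟩ : p.coeff n ∈ Set.range ι := hι ▸ subset_fracSet B (hcoeff n)
      refine ⟨⟨a, ?_⟩, ha⟩
      rw [Subalgebra.mem_comap, ha]
      exact hcoeff n
    obtain ⟨q, rfl, -, hq⟩ := lifts_and_natDegree_eq_and_monic hlift hp
    refine ⟨q, hq, ι.toRingHom.injective ?_⟩
    rw [heval] at heq
    rw [map_zero]
    exact heq
  · rintro ⟨q, hq, heq⟩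
    refine ⟨hι ▸ ⟨k, rfl⟩, q.map φ, hq.map φ, fun i => ?_, ?_⟩
    · rw [coeff_map]
      exact (q.coeff i).2
    · rw [heval, heq, map_zero]

end FracField

/-! ### Ad-nilpotency -/

section AdNilpotent

variable {R : Type*} [Ring R] [Algebra ℂ R]

theorem adRight_pow_eq_zero_of_mem_adKernel {B : Subalgebra ℂ R} {k : ℕ} {a b : R}
    (ha : a ∈ adKernel B k) (hb : b ∈ B) : (adRight b ^ (k + 1)) a = 0 := by
  have h := ha (List.replicate (k + 1) b) List.length_replicate
    fun c hc => by rw [List.eq_of_mem_replicate hc]; exact hb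
  have key : ∀ n : ℕ, (List.replicate n b).foldr (fun b c => b * c - c * b) a
      = (-1 : ℂ) ^ n • (adRight b ^ n) a := by
    intro n
    induction n with
    | zero => simp
    | succ n ih =>
      rw [List.replicate_succ, List.foldr_cons, ih, pow_succ' (adRight b), Module.End.mul_apply,
        adRight_apply b ((adRight b ^ n) a), pow_succ, mul_smul_comm, smul_mul_assoc, ← smul_sub,
        mul_neg_one, neg_smul, ← smul_neg, neg_sub]
  rw [key, smul_eq_zero] at h
  exact h.resolve_left (pow_ne_zero _ (by simp))

theorem adRight_pow_coe (D : Subalgebra ℂ R) (b a : D) (n : ℕ) :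
    (((adRight b ^ n) a : D) : R) = (adRight (b : R) ^ n) a := by
  induction n with
  | zero => simp
  | succ n ih =>
    rw [pow_succ', pow_succ', Module.End.mul_apply, Module.End.mul_apply, ← ih, adRight_apply,
      adRight_apply]
    simp

theorem adRight_pow_mem {D : Subalgebra ℂ R} {b a : R} (hb : b ∈ D) (ha : a ∈ D) (n : ℕ) :
    (adRight b ^ n) a ∈ D := by
  rw [← adRight_pow_coe D ⟨b, hb⟩ ⟨a, ha⟩]
  exact Subtype.property _

theorem exists_adRight_order {b a : R} {N : ℕ} (hN : (adRight b ^ N) a = 0)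
    (ha : adRight b a ≠ 0) :
    ∃ m : ℕ, (adRight b ^ (m + 1)) a ≠ 0 ∧ (adRight b ^ (m + 2)) a = 0 := by
  classical
  have hex : ∃ N, (adRight b ^ N) a = 0 := ⟨N, hN⟩
  obtain ⟨m, hm⟩ : ∃ m, Nat.find hex = m + 2 := by
    have hspec := Nat.find_spec hex
    rcases hk : Nat.find hex with _ | _ | m
    · rw [hk, pow_zero, Module.End.one_apply] at hspec
      exact absurd (by rw [hspec, map_zero]) ha
    · rw [hk, zero_add, pow_one] at hspec
      exact absurd hspec ha
    · exact ⟨m, rfl⟩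
  exact ⟨m, Nat.find_min hex (by omega), hm ▸ Nat.find_spec hex⟩

end AdNilpotent

/-! ### Consequences of two distinct mad subalgebras -/

section Main

variable {Q : Type*} [DivisionRing Q] [Algebra ℂ Q]

/-- Centralizers of elements that are not scalars are commutative. -/
def HasCommutativeCentralizers (Q : Type*) [Ring Q] [Algebra ℂ Q] : Prop :=
  ∀ b : Q, (∀ c : ℂ, b ≠ algebraMap ℂ Q c) → ∀ p q : Q, p * b = b * p → q * b = b * q →
    p * q = q * p

theorem mem_map_val_iff {D : Subalgebra ℂ Q} {B : Subalgebra ℂ D} {p : Q} :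
    p ∈ B.map D.val ↔ ∃ h : p ∈ D, (⟨p, h⟩ : D) ∈ B := by
  constructor
  · rintro ⟨d, hd, rfl⟩
    exact ⟨d.2, hd⟩
  · rintro ⟨h, h'⟩
    exact ⟨⟨p, h⟩, h', rfl⟩

theorem IsMad.adRight_pow_eq_zero {D : Subalgebra ℂ Q} {B : Subalgebra ℂ D} (hB : IsMad B)
    {b d : Q} (hb : b ∈ B.map D.val) (hd : d ∈ D) : ∃ N, (adRight b ^ N) d = 0 := by
  obtain ⟨hbD, hb⟩ := mem_map_val_iff.1 hb
  obtain ⟨k, hk⟩ := hB.adNilpotent ⟨d, hd⟩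
  refine ⟨k + 1, ?_⟩
  have h := adRight_pow_coe D ⟨b, hbD⟩ ⟨d, hd⟩ (k + 1)
  rw [adRight_pow_eq_zero_of_mem_adKernel hk hb] at h
  exact h.symm

theorem IsMad.commute {D : Subalgebra ℂ Q} {B : Subalgebra ℂ D} (hB : IsMad B)
    {p q : Q} (hp : p ∈ B.map D.val) (hq : q ∈ B.map D.val) : p * q = q * p := by
  obtain ⟨hpD, hp⟩ := mem_map_val_iff.1 hp
  obtain ⟨hqD, hq⟩ := mem_map_val_iff.1 hq
  rw [← hB.centralizer_eq, Subalgebra.mem_centralizer_iff] at hq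
  exact congrArg Subtype.val (hq _ hp)

theorem IsMad.mem_of_commute {D : Subalgebra ℂ Q} {B : Subalgebra ℂ D} (hB : IsMad B)
    {p : Q} (hp : p ∈ D) (h : ∀ b ∈ B.map D.val, b * p = p * b) : p ∈ B.map D.val := by
  refine mem_map_val_iff.2 ⟨hp, ?_⟩
  rw [← hB.centralizer_eq, Subalgebra.mem_centralizer_iff]
  intro b hb
  exact Subtype.ext (h b (mem_map_val_iff.2 ⟨b.2, hb⟩))

/-- Both p and all of B lie in the centralizer of b, which is commutative; hence p centralizes B. -/
theorem IsMad.mem_of_commute_single {D : Subalgebra ℂ Q} {B : Subalgebra ℂ D} (hB : IsMad B)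
    (hQ : HasCommutativeCentralizers Q) {b p : Q} (hb : b ∈ B.map D.val)
    (hbc : ∀ c : ℂ, b ≠ algebraMap ℂ Q c) (hp : p ∈ D) (h : adRight b p = 0) :
    p ∈ B.map D.val :=
  hB.mem_of_commute hp fun b' hb' =>
    hQ b hbc b' p (hB.commute hb' hb) (adRight_eq_zero_iff.1 h)

theorem IsMad.exists_not_scalar {D : Subalgebra ℂ Q} {B : Subalgebra ℂ D} (hB : IsMad B)
    (hD : ∃ p ∈ D, ∃ q ∈ D, p * q ≠ q * p) :
    ∃ b ∈ B.map D.val, ∀ c : ℂ, b ≠ algebraMap ℂ Q c := by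
  by_contra! hcon
  obtain ⟨p, hp, q, hq, hpq⟩ := hD
  have hall : ∀ d ∈ D, d ∈ B.map D.val := fun d hd => hB.mem_of_commute hd fun b hb => by
    obtain ⟨c, rfl⟩ := hcon b hb
    exact Algebra.commutes c d
  exact hpq (hB.commute (hall p hp) (hall q hq))

/-- Taking centralizers reverses inclusions, so B' ≤ B would give B ≤ B'. -/
theorem exists_not_mem_of_isMad {D : Subalgebra ℂ Q} {B B' : Subalgebra ℂ D} (hB : IsMad B)
    (hB' : IsMad B') (hne : B' ≠ B) : ∃ b ∈ B'.map D.val, b ∉ B.map D.val := by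
  by_contra! hcon
  have hle : B' ≤ B := by
    intro b hb
    obtain ⟨_, h⟩ := mem_map_val_iff.1 (hcon b (mem_map_val_iff.2 ⟨b.2, hb⟩))
    exact h
  refine hne (le_antisymm hle ?_)
  rw [← hB.centralizer_eq, ← hB'.centralizer_eq]
  exact Subalgebra.centralizer_le ℂ _ _ hle

/-- The derivation of a field induced by an inner derivation of an ambient skew field. -/
theorem exists_induced_derivation {K : Type*} [Field K] [Algebra ℂ K] (ι : K →ₐ[ℂ] Q) (y : Q)
    (h : ∀ k, y * ι k - ι k * y ∈ Set.range ι) :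
    ∃ δ : Derivation ℂ K K, ∀ k, ι (δ k) = y * ι k - ι k * y := by
  have hinj : Function.Injective ι := ι.toRingHom.injective
  choose f hf using h
  let L : K →ₗ[ℂ] K :=
    { toFun := f
      map_add' := fun p q => hinj (by simp only [hf, map_add]; noncomm_ring)
      map_smul' := fun c p => hinj (by
        simp only [hf, map_smul, RingHom.id_apply, mul_smul_comm, smul_mul_assoc, smul_sub]) }
  refine ⟨Derivation.mk' L fun p q => hinj ?_, hf⟩
  change ι (f (p * q)) = ι (p * f q + q * f p)
  rw [mul_comm q]
  simp only [hf, map_mul, map_add]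
  noncomm_ring

/-- The quotient rule extends [y, ·] from B to its fractions. -/
theorem bracket_mem_fracSet {K : Type*} [Field K] [Algebra ℂ K] {B : Subalgebra ℂ Q}
    {ι : K →ₐ[ℂ] Q} (hι : Set.range ι = fracSet B) {y : Q}
    (h : ∀ b ∈ B, y * b - b * y ∈ fracSet B) (k : K) : y * ι k - ι k * y ∈ Set.range ι := by
  obtain ⟨a, ha, b, hb, hb0, hk⟩ : ι k ∈ fracSet B := hι ▸ ⟨k, rfl⟩
  obtain ⟨a', ha'⟩ : a ∈ Set.range ι := hι ▸ subset_fracSet B ha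
  obtain ⟨b', hb'⟩ : b ∈ Set.range ι := hι ▸ subset_fracSet B hb
  obtain ⟨p, hp⟩ : y * a - a * y ∈ Set.range ι := hι ▸ h a ha
  obtain ⟨q, hq⟩ : y * b - b * y ∈ Set.range ι := hι ▸ h b hb
  refine ⟨p * b'⁻¹ - a' * b'⁻¹ * q * b'⁻¹, ?_⟩
  have hinv : y * b⁻¹ - b⁻¹ * y = -(b⁻¹ * (y * b - b * y) * b⁻¹) := by
    rw [mul_sub, sub_mul, ← mul_assoc, ← mul_assoc, inv_mul_cancel₀ hb0, mul_assoc (b⁻¹ * y),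
      mul_inv_cancel₀ hb0]
    noncomm_ring
  have h2 : y * (a * b⁻¹) - a * b⁻¹ * y
      = (y * a - a * y) * b⁻¹ + a * (y * b⁻¹ - b⁻¹ * y) := by
    noncomm_ring
  rw [hk, h2, hinv]
  simp only [map_sub, map_mul, map_inv₀, hp, hq, ha', hb']
  noncomm_ring

/-- Iterated commutators with `e'` act on symbols by iterated twisted derivations. -/
theorem twistIter_eq_zero_of_isSymbol {K : Type*} [Field K] [Algebra ℂ K] {ι : K →ₐ[ℂ] Q}
    {b y : Q} (H : HasSlice b y) {δ : Derivation ℂ K K}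
    (hδ : ∀ k, ι (δ k) = y * ι k - ι k * y) {e' : Q} {m : ℕ} {a : K}
    (he' : IsSymbol b e' (m + 1) (ι a)) (N : ℕ) : ∀ {e : Q} {j : ℕ} {g : K},
    IsSymbol b e (j * m) (ι g) → (adRight e' ^ N) e = 0 → twistIter δ a (m + 1) N j g = 0 := by
  induction N with
  | zero =>
    intro e j g he h0
    rw [pow_zero, Module.End.one_apply] at h0
    have h1 := he.2
    rw [h0, map_zero, eq_comm, smul_eq_zero] at h1
    have h2 := h1.resolve_left (by exact_mod_cast (j * m).factorial_ne_zero)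
    exact (map_eq_zero_iff ι ι.toRingHom.injective).1 h2
  | succ N ih =>
    intro e j g he h0
    rw [twistIter]
    -- Bracketing with a symbol of order m + 1 raises the order by m, from j m to (j + 1) m, which
    -- is the step of the index in `twist`.
    have h1 := H.isSymbol_commutator ((j + 1) * m) (by ring) he' he
    have h2 : ((m + 1 : ℕ) : ℂ) • (ι a * (y * ι g - ι g * y))
        - ((j * m : ℕ) : ℂ) • (ι g * (y * ι a - ι a * y)) = ι (twist δ a (m + 1) j g) := by
      rw [← hδ, ← hδ, ← map_mul, ← map_mul, ← map_smul, ← map_smul, ← map_sub, twist_apply,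
        Algebra.smul_def, Algebra.smul_def]
      congr 1
      push_cast
      ring
    rw [h2] at h1
    have h3 : (adRight e' ^ N) (e' * e - e * e') = 0 := by
      rw [pow_succ, Module.End.mul_apply, adRight_apply] at h0
      rw [← neg_sub, map_neg, h0, neg_zero]
    have := ih h1 h3
    push_cast at this
    exact this

theorem integralClosureSet_eq_adjoin.{u} {Q : Type u} [DivisionRing Q] [Algebra ℂ Q]
    (hQ : HasCommutativeCentralizers Q) {D : Subalgebra ℂ Q}
    (hD : ∃ p ∈ D, ∃ q ∈ D, p * q ≠ q * p) {B B' : Subalgebra ℂ D} (hB : IsMad B)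
    (hB' : IsMad B') (hne : B' ≠ B) :
    ∃ x : Q, Transcendental ℂ x ∧
      integralClosureSet (B.map D.val) = (Algebra.adjoin ℂ {x} : Set Q) := by
  obtain ⟨b, hb, hbc⟩ := hB.exists_not_scalar hD
  have hBD : ∀ {p}, p ∈ B.map D.val → p ∈ D := fun h => (mem_map_val_iff.1 h).1
  have hmem : ∀ {p}, p ∈ D → adRight b p = 0 → p ∈ B.map D.val :=
    fun hp h => hB.mem_of_commute_single hQ hb hbc hp h
  have hker : ∀ {p}, p ∈ B.map D.val → adRight b p = 0 :=
    fun hp => adRight_eq_zero_iff.2 (hB.commute hp hb)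
  obtain ⟨f, hf, hf0, hf1⟩ : ∃ f ∈ D, adRight b f ≠ 0 ∧ adRight b (adRight b f) = 0 := by
    obtain ⟨p, hp, q, hq, hpq⟩ := hD
    obtain ⟨r, hr, hr0⟩ : ∃ r ∈ D, adRight b r ≠ 0 := by
      by_contra! hcon
      exact hpq (hB.commute (hmem hp (hcon p hp)) (hmem hq (hcon q hq)))
    obtain ⟨N, hN⟩ := hB.adRight_pow_eq_zero hb hr
    obtain ⟨m, hm, hm'⟩ := exists_adRight_order hN hr0
    refine ⟨(adRight b ^ m) r, adRight_pow_mem (hBD hb) hr m, ?_, ?_⟩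
    · rwa [← Module.End.mul_apply, ← pow_succ']
    · rwa [← Module.End.mul_apply, ← Module.End.mul_apply, mul_assoc, ← pow_succ', ← pow_succ']
  have hcB : adRight b f ∈ B.map D.val := hmem (by
    rw [adRight_apply]
    exact D.sub_mem (D.mul_mem hf (hBD hb)) (D.mul_mem (hBD hb) hf)) hf1
  set c := adRight b f with hc
  -- As c = [f, b] commutes with b, division by it turns f into a slice.
  set y := c⁻¹ * f with hy
  have H : HasSlice b y := by
    refine ⟨?_, fun p q hp hq => hQ b hbc p q (adRight_eq_zero_iff.1 hp)
      (adRight_eq_zero_iff.1 hq)⟩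
    have hcinv : adRight b c⁻¹ = 0 :=
      adRight_eq_zero_iff.2 (Commute.inv_left₀ (adRight_eq_zero_iff.1 hf1)).eq
    rw [hy, adRight_mul, hcinv, zero_mul, zero_add, ← hc, inv_mul_cancel₀ hf0]
  obtain ⟨K, _, _, ι, hι⟩ := exists_fracField (B.map D.val) fun p hp q hq => hB.commute hp hq
  have hinj : Function.Injective ι := ι.toRingHom.injective
  have hlift : ∀ {p}, p ∈ B.map D.val → ∃ k, ι k = p := fun {p} hp => by
    have : p ∈ Set.range ι := hι ▸ subset_fracSet _ hp
    exact this
  have hybr : ∀ p ∈ B.map D.val, y * p - p * y ∈ fracSet (B.map D.val) := by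
    intro p hp
    have h1 : f * p - p * f ∈ B.map D.val := by
      refine hmem (D.sub_mem (D.mul_mem hf (hBD hp)) (D.mul_mem (hBD hp) hf)) ?_
      rw [adRight_commutator, hker hp, ← hc, hB.commute hcB hp]
      simp
    refine ⟨_, h1, c, hcB, hf0, ?_⟩
    have h2 : Commute c⁻¹ p := Commute.inv_left₀ (hB.commute hcB hp)
    have h3 : Commute c⁻¹ (f * p - p * f) := Commute.inv_left₀ (hB.commute hcB h1)
    rw [← h3.eq, hy, ← mul_assoc p, ← h2.eq, mul_sub]
    simp only [mul_assoc]
  obtain ⟨δ, hδ⟩ := exists_induced_derivation ι y (bracket_mem_fracSet hι hybr)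
  obtain ⟨β, hβ⟩ := hlift hb
  have hβc : ∀ c : ℂ, β ≠ algebraMap ℂ K c := by
    rintro c rfl
    exact hbc c (by rw [← hβ, ι.commutes])
  have hβδ : δ β = 1 := by
    apply hinj
    rw [hδ, hβ, map_one, ← adRight_apply, H.slice]
  -- Such a k commutes with both y and b. If it were not a scalar, its commutative centralizer would
  -- contain y and b, contrary to [y, b] = 1.
  have hconst : ∀ k : K, δ k = 0 → ∃ c : ℂ, k = algebraMap ℂ K c := by
    intro k hk
    by_contra! hcon
    have h1 : y * ι k = ι k * y := by rw [← sub_eq_zero, ← hδ, hk, map_zero]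
    have h2 : b * ι k = ι k * b := by rw [← hβ, ← map_mul, ← map_mul, mul_comm]
    have h3 := hQ (ι k) (fun c hc => hcon c (hinj (by rw [hc, ι.commutes]))) y b h1 h2
    have h4 := H.slice
    rw [adRight_apply, h3, sub_self] at h4
    exact zero_ne_one h4
  obtain ⟨e, he, heB⟩ := exists_not_mem_of_isMad hB hB' hne
  have heD : e ∈ D := (mem_map_val_iff.1 he).1
  obtain ⟨N, hN⟩ := hB.adRight_pow_eq_zero hb heD
  -- Since e is outside B it does not commute with b, so its order m + 1 is positive.
  obtain ⟨m, hm, hm'⟩ := exists_adRight_order hN fun h => heB (hmem heD h)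
  rw [pow_succ', Module.End.mul_apply] at hm'
  obtain ⟨a', ha'⟩ := hlift (hmem (adRight_pow_mem (hBD hb) heD (m + 1)) hm')
  have hfac : ((m + 1).factorial : ℂ) ≠ 0 := by exact_mod_cast (m + 1).factorial_ne_zero
  set a : K := ((m + 1).factorial : ℂ)⁻¹ • a' with ha
  have ha0 : a ≠ 0 := by
    refine smul_ne_zero (inv_ne_zero hfac) ?_
    rintro rfl
    exact hm (by rw [← ha', map_zero])
  have hsymb : IsSymbol b e (m + 1) (ι a) := by
    constructor
    · rw [ha, map_smul, map_smul, ha', hm', smul_zero]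
    · rw [ha, map_smul, smul_smul, mul_inv_cancel₀ hfac, one_smul, ha']
  obtain ⟨x, hx⟩ := exists_subset_adjoin_of_twist hconst ha0 m.succ_pos
    {k | ι k ∈ B.map D.val} (fun k hk => by
      obtain ⟨N, hN⟩ := hB'.adRight_pow_eq_zero he (hBD hk)
      refine ⟨N, ?_⟩
      -- Elements of B have order 0 and are their own symbols, so the iteration starts at index 0.
      have := twistIter_eq_zero_of_isSymbol H hδ hsymb N (e := ι k) (j := 0) (g := k)
        ⟨hker hk, by simp⟩ hN
      simpa using this) (b₁ := β) (by rw [Set.mem_ofPred_eq, hβ]; exact hb)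
    (by rw [hβδ]; exact one_ne_zero)
  have hle : (B.map D.val).comap ι ≤ Algebra.adjoin ℂ {x} := fun k hk => hx hk
  have hβB : β ∈ (B.map D.val).comap ι := by
    rw [Subalgebra.mem_comap, hβ]
    exact hb
  have hfracK : ∀ k : K, ∃ p ∈ (B.map D.val).comap ι, ∃ q ∈ (B.map D.val).comap ι,
      k = p / q := by
    intro k
    obtain ⟨p, hp, q, hq, -, hk⟩ : ι k ∈ fracSet (B.map D.val) := hι ▸ ⟨k, rfl⟩
    obtain ⟨p', rfl⟩ := hlift hp
    obtain ⟨q', rfl⟩ := hlift hq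
    exact ⟨p', hp, q', hq, hinj (by rw [hk, map_div₀, div_eq_mul_inv])⟩
  refine ⟨ι x, ?_, ?_⟩
  · intro halg
    exact transcendental_of_adjoin hβc (hle hβB) ((isAlgebraic_algHom_iff ι hinj).1 halg)
  · rw [← AlgHom.map_adjoin_singleton]
    ext q
    constructor
    · intro hq
      obtain ⟨k, rfl⟩ : q ∈ Set.range ι := hι ▸ hq.1
      exact ⟨k, (isIntegral_iff_mem_adjoin hle hfracK hβB hβc k).1
        ((mem_integralClosureSet_iff hι k).1 hq), rfl⟩
    · rintro ⟨k, hk, rfl⟩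
      exact (mem_integralClosureSet_iff hι k).2
        ((isIntegral_iff_mem_adjoin hle hfracK hβB hβc k).2 hk)

theorem exists_not_commute_of_hasQuotientField {D : Subalgebra ℂ Q} (hD : HasQuotientField D)
    (hQ : ∃ p q : Q, p * q ≠ q * p) : ∃ p ∈ D, ∃ q ∈ D, p * q ≠ q * p := by
  by_contra! hcon
  obtain ⟨p, q, hpq⟩ := hQ
  refine hpq (fracSet_commute (B := D) hcon ?_ ?_)
  · obtain ⟨b, hb, a, ha, hb0, h⟩ := hD p
    exact ⟨a, ha, b, hb, hb0, h⟩
  · obtain ⟨b, hb, a, ha, hb0, h⟩ := hD q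
    exact ⟨a, ha, b, hb, hb0, h⟩

end Main

theorem theorem4p1 (D : Subalgebra ℂ WeylField) (hQ : HasQuotientField D)
    (hmad : ∃ B₁ B₂ : Subalgebra ℂ D, IsMad B₁ ∧ IsMad B₂ ∧ B₁ ≠ B₂)
    (B : Subalgebra ℂ D) (hB : IsMad B) :
    ∃ x : WeylField, Transcendental ℂ x ∧
      integralClosureSet (B.map D.val) = (Algebra.adjoin ℂ {x} : Set WeylField) := by
  obtain ⟨B', hB', hne⟩ : ∃ B', IsMad B' ∧ B' ≠ B := by
    obtain ⟨B₁, B₂, h₁, h₂, h⟩ := hmad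
    by_cases h1 : B₁ = B
    · exact ⟨B₂, h₂, fun h2 => h (h1.trans h2.symm)⟩
    · exact ⟨B₁, h₁, h1⟩
  exact integralClosureSet_eq_adjoin (fun _ hb _ _ => weylField_commute hb)
    (exists_not_commute_of_hasQuotientField hQ weylField_not_commutative) hB hB' hne
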